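/- Let $M>0$, $|a|=M$ (extremal Kerr), so that $r_+=M$, $\Delta=r^2-2Mr+a^2=(r-M)^2$ and $\omega_+=\frac{a}{2Mr_+}$. Let $s\in\frac12\mathbb Z$, let $m\neq 0$ be an integer if $s$ is an integer and a half-integer if $s$ is a half-integer, let $\lambda\in\mathbb R$, and let $\omega=m\omega_+$. Put $K=\omega(r^2+a^2)-am$ and $\mathcal D^{\pm}=\frac{d}{dr}\pm\frac{iK}{\Delta}$. Let $R:(r_+,\infty)\to\mathbb C$ be a classical solution of the homogeneous radial Teukolsky equation $$\Delta^{-s}\frac{d}{dr}\Big(\Delta^{s+1}\frac{dR}{dr}\Big)+\Big(\frac{K^2-2is(r-M)K}{\Delta}+4is\omega r-\lambda-a^2\omega^2+2am\omega\Big)R=0 .$$ Let $\Sigma=\{t=h(r)\}$ (Boyer–Lindquist time $t$, $h\in C^1(r_+,\infty)$) be a hyperboloidal hypersurface: with $H=\frac{\Delta}{r^2+a^2}h'$, it is spacelike, that is $\Delta^2h'^2<(r^2+a^2)^2-a^2\Delta\sin^2\theta$ for all $r>r_+$ and all $\theta$; it meets the future event horizon, that is $1+H=O(\Delta)$ as $r\to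 r_+$; and it is asymptotically null, that is $1-H=O(r^{-2})$ as $r\to\infty$. Set $\Psi=(r^2+a^2)^{1/2}\Delta^sR$ and, for a function $\chi$ of $r$, $$e_\Sigma[\chi]=\Big[(1+H)\Big|\tfrac{\Delta}{r^2+a^2}\mathcal D^-\chi\Big|^2+(1-H)\Big|\tfrac{\Delta}{r^2+a^2}\mathcal D^+\chi\Big|^2+\tfrac{\Delta}{(r^2+a^2)^2}|\chi|^2\Big]\frac{r^2+a^2}{\Delta}.$$ Say that $R$ has finite energy along $\Sigma$ if $$\sum_{0\le j\le |s|+s}\ \int_{r_+}^{3M}e_\Sigma\big[(\mathcal D^+)^j\Psi\big]\,dr+\sum_{0\le j\le |s|-s}\ \int_{3M}^{\infty}e_\Sigma\big[((r^2+a^2)\mathcal D^-)^j\Psi\big]\,dr<\infty$$ (for $s=0$ this is finiteness of the usual energy of a scalar mode, with the transversal derivative weighted degenerately at the horizon). Then, if $R$ has finite energy along a hyperboloidal hypersurface $\Sigma$, $R\equiv0$ on $(r_+,\infty)$. In other words, at the superradiant threshold $\omega=m\omega_+$, $m\ne0$, the homogeneous radial equation has no nontrivial solution with finite energy along a hyperboloidal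 hypersurface. -/

import Mathlib

open scoped ENNReal

noncomputable section

namespace KerrTeukolsky

/-! Background quantities of the Kerr exterior with mass `M` and specific angular momentum `a`. -/

/-- The horizon function `Δ = r² - 2Mr + a²`. -/
def Delta (M a r : ℝ) : ℝ := r ^ 2 - 2 * M * r + a ^ 2

/-- The radius of the event horizon, `r₊ = M + √(M² - a²)`. -/
def rPlus (M a : ℝ) : ℝ := M + Real.sqrt (M ^ 2 - a ^ 2)

/-- The angular velocity of the horizon, `ω₊ = a / (2 M r₊)`. -/
def omegaPlus (M a : ℝ) : ℝ := a / (2 * M * rPlus M a)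

/-- `K = ω (r² + a²) - a m`. -/
def K (a ω m r : ℝ) : ℝ := ω * (r ^ 2 + a ^ 2) - a * m

/-- `m` is admissible with respect to the spin `s`: it is an integer if `s` is one, and a (proper)
half-integer if `s` is one. -/
def Admissible (s m : ℝ) : Prop :=
  ((∃ k : ℤ, s = k) → ∃ j : ℤ, m = j) ∧
    ((∃ k : ℤ, s = k + 1 / 2) → ∃ j : ℤ, m = j + 1 / 2)

/-- The left-hand side of the radial Teukolsky equation of spin `s`,
`Δ^{-s} (Δ^{s+1} R')' + ((K² - 2 i s (r - M) K) / Δ + 4 i s ω r - lam - a² ω² + 2 a m ω) R`. -/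
def radialOp (M a s ω m lam : ℝ) (R : ℝ → ℂ) (r : ℝ) : ℂ :=
  ((Delta M a r ^ (-s) : ℝ) : ℂ) *
      deriv (fun y => ((Delta M a y ^ (s + 1) : ℝ) : ℂ) * deriv R y) r
    + (((K a ω m r : ℂ) ^ 2 - 2 * Complex.I * s * (r - M) * (K a ω m r : ℂ)) / (Delta M a r : ℂ))
        * R r
    + (4 * Complex.I * s * ω * r - lam - a ^ 2 * ω ^ 2 + 2 * a * m * ω) * R r

/-- Classical solutions on `(r₊, ∞)` of the homogeneous radial Teukolsky equation. -/
structure IsRadialSolution (M a s ω m lam : ℝ) (R : ℝ → ℂ) : Prop where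
  contDiffOn : ContDiffOn ℝ 2 R (Set.Ioi (rPlus M a))
  eq_zero : ∀ r, rPlus M a < r → radialOp M a s ω m lam R r = 0

/-- `𝒟⁺ = d/dr + i K / Δ`: the action on modes `e^{-iωt} e^{imφ} f(r)` of the ingoing principal null
derivative `∂_r - ((r² + a²)/Δ) ∂_t - (a/Δ) ∂_φ`, which is the vector field `∂_r` of the Kerr-star
coordinates and is regular and transversal at the future event horizon. -/
def DPlus (M a ω m : ℝ) (f : ℝ → ℂ) (r : ℝ) : ℂ :=
  deriv f r + Complex.I * ((K a ω m r / Delta M a r : ℝ) : ℂ) * f r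

/-- `𝒟⁻ = d/dr - i K / Δ`: the action on modes `e^{-iωt} e^{imφ} f(r)` of the outgoing principal null
derivative `∂_r + ((r² + a²)/Δ) ∂_t + (a/Δ) ∂_φ`. -/
def DMinus (M a ω m : ℝ) (f : ℝ → ℂ) (r : ℝ) : ℂ :=
  deriv f r - Complex.I * ((K a ω m r / Delta M a r : ℝ) : ℂ) * f r

/-- The slope `dh/dr⋆ = (Δ / (r² + a²)) dh/dr` of the hypersurface `{t = h(r)}`. -/
def slope (M a : ℝ) (h : ℝ → ℝ) (r : ℝ) : ℝ := Delta M a r / (r ^ 2 + a ^ 2) * deriv h r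

/-- `{t = h(r)}` (in Boyer-Lindquist coordinates) is a hyperboloidal hypersurface: it is spacelike
for the Kerr metric, i.e. `g^{tt} + (h')² g^{rr} < 0` at all angles; it meets the future event
horizon, i.e. along it the Kerr-star time `t + ∫ (r² + a²)/Δ` has bounded `r`-derivative as
`r → r₊`; and it is asymptotically null, `1 - dh/dr⋆ = O(r⁻²)`, as `r → ∞`.
(For `a ≠ 0` spacelikeness bounds `1 + dh/dr⋆` and `1 - dh/dr⋆` from below by multiples of `Δ` near
the horizon and of `r⁻²` near infinity, respectively.) -/
structure IsHyperboloidal (M a : ℝ) (h : ℝ → ℝ) : Prop where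
  contDiffOn : ContDiffOn ℝ 1 h (Set.Ioi (rPlus M a))
  spacelike : ∀ r, rPlus M a < r → ∀ θ : ℝ,
    Delta M a r ^ 2 * deriv h r ^ 2 <
      (r ^ 2 + a ^ 2) ^ 2 - a ^ 2 * Delta M a r * Real.sin θ ^ 2
  meets_horizon : ∃ C : ℝ, ∀ r, rPlus M a < r → 1 + slope M a h r ≤ C * Delta M a r
  meets_scri : ∃ C : ℝ, ∀ r, rPlus M a < r → 1 - slope M a h r ≤ C / r ^ 2

/-- The energy density, with respect to `dr`, on `{t = h(r)}` of a mode with rescaled radial part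
`χ`:
`[(1 + h_{r⋆}) |L χ|² + (1 - h_{r⋆}) |L̲ χ|² + Δ (r² + a²)⁻² |χ|²] dr⋆`,
where `L = (Δ/(r² + a²)) 𝒟⁻`, `L̲ = -(Δ/(r² + a²)) 𝒟⁺`, and the last term stands for the angular
derivatives. The weight of the transversal derivative degenerates at the horizon, so that finiteness
is a weaker requirement here than for the nondegenerate energy. -/
def energyDensity (M a ω m : ℝ) (h : ℝ → ℝ) (χ : ℝ → ℂ) (r : ℝ) : ℝ :=
  ((1 + slope M a h r) * ‖((Delta M a r / (r ^ 2 + a ^ 2) : ℝ) : ℂ) * DMinus M a ω m χ r‖ ^ 2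
    + (1 - slope M a h r) * ‖((Delta M a r / (r ^ 2 + a ^ 2) : ℝ) : ℂ) * DPlus M a ω m χ r‖ ^ 2
    + Delta M a r / (r ^ 2 + a ^ 2) ^ 2 * ‖χ r‖ ^ 2)
  * ((r ^ 2 + a ^ 2) / Delta M a r)

/-- The radial part rescaled by the powers of `Δ` and `r² + a²` for which outgoing modes are regular
at the future event horizon and at future null infinity: `Ψ = (r² + a²)^{1/2} Δ^s R`. -/
def regularField (M a s : ℝ) (R : ℝ → ℂ) (r : ℝ) : ℂ :=
  ((Real.sqrt (r ^ 2 + a ^ 2) * Delta M a r ^ s : ℝ) : ℂ) * R r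

/-- The energy on `{t = h(r)}` of the spin `s` mode with radial part `R`: near the horizon, the
energies of `Ψ` and its transversal derivatives `(𝒟⁺)^j Ψ`, `j ≤ |s| + s`; near infinity, the
energies of `Ψ` and its weighted outgoing derivatives `((r² + a²) 𝒟⁻)^j Ψ`, `j ≤ |s| - s`.
For `s = 0` it is the energy of a scalar mode. -/
def hyperboloidalEnergy (M a s ω m : ℝ) (h : ℝ → ℝ) (R : ℝ → ℂ) : ℝ≥0∞ :=
  (∑ j ∈ Finset.range (⌊|s| + s⌋₊ + 1), ∫⁻ r in Set.Ioc (rPlus M a) (3 * M),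
      ENNReal.ofReal (energyDensity M a ω m h
        ((fun (f : ℝ → ℂ) (y : ℝ) => DPlus M a ω m f y)^[j] (regularField M a s R)) r))
    + ∑ j ∈ Finset.range (⌊|s| - s⌋₊ + 1), ∫⁻ r in Set.Ioi (3 * M),
      ENNReal.ofReal (energyDensity M a ω m h
        ((fun (f : ℝ → ℂ) (y : ℝ) => ((y ^ 2 + a ^ 2 : ℝ) : ℂ) * DMinus M a ω m f y)^[j]
          (regularField M a s R)) r)

end KerrTeukolsky

end

open Set MeasureTheory Filter Topology

namespace KerrTeukolsky

noncomputable section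

/-! Write x = r - M. At extremality and threshold frequency, K = ω (r + M) x vanishes on the
horizon, so u = x^(s+1) R solves the Whittaker-type equation u'' + (ω² + (4Mω² + 2iωs)/x + q/x²) u =
0 with q real. The horizon is a regular singular point of it. The spin enters, for given q, only
through the 1/x coefficient: first-order ladder operators shift it by ±1 at fixed q (`raise`), and
complex conjugation of the equation reverses it.

Let t = |s|, let U be the member of the ladder of u with spin t, and let W, of spin -t, be U lowered
2t times. Finite energy makes x^(t-1) U, x^t U', x^(-t-1) W and x^(-t) W' square integrable near the
horizon, and makes U outgoing in the mean square sense at infinity. The current of U and the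
conjugate of W is a constant c. By Cauchy–Schwarz c/x is integrable at x = 0, so c = 0
(`wronskian_eq_zero`). At infinity, lowering an outgoing solution is multiplication by 2iωx up to
square integrable errors (`memLp_lower_ladder`), so the current is a nonzero multiple of |x^t U|² to
leading order. Its vanishing forces x^t U and x^t U' to be square integrable (`eq_zero_of_regular`),
which is faster decay than a nonzero solution admits (`eq_zero_of_memLp_Ioi`). Here ω ≠ 0, that is m
≠ 0, is essential.

For s ≥ 0, U is u itself, and the 2s transversal derivatives of Ψ in the horizon energy become W
through a Bol-type identity (`iterate_twistedDeriv_bol`). For s < 0, U is u raised 2|s| times, which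
is what the weighted outgoing derivatives of Ψ at infinity control. Then U = 0 gives u = 0, because
raising is injective on solutions regular at the horizon (`eq_zero_of_ladder_eq_zero`). -/

/-- The twisted derivative `g (d/dr + ψ)`. -/
def twistedDeriv (g ψ f : ℝ → ℂ) (r : ℝ) : ℂ := g r * (deriv f r + ψ r * f r)

/-! ### Calculus of the operators g (d/dr + ψ) -/

section TwistedDeriv

variable {M : ℝ} {g ψ : ℝ → ℂ}

lemma ContDiffOn.deriv_Ioi {f : ℝ → ℂ} (hf : ContDiffOn ℝ (⊤ : ℕ∞) f (Ioi M)) :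
    ContDiffOn ℝ (⊤ : ℕ∞) (deriv f) (Ioi M) :=
  hf.deriv_of_isOpen isOpen_Ioi (by simp)

lemma ContDiffOn.hasDerivAt_Ioi {f : ℝ → ℂ} (hf : ContDiffOn ℝ (⊤ : ℕ∞) f (Ioi M)) {r : ℝ} (hr : M < r) :
    HasDerivAt f (deriv f r) r :=
  ((hf.differentiableOn (by simp)).differentiableAt (Ioi_mem_nhds hr)).hasDerivAt

lemma deriv_eqOn_Ioi {f f' : ℝ → ℂ} (h : EqOn f f' (Ioi M)) :
    EqOn (deriv f) (deriv f') (Ioi M) := fun _ hr =>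
  (h.eventuallyEq_of_mem (Ioi_mem_nhds hr)).deriv_eq

lemma contDiffOn_twistedDeriv (hg : ContDiffOn ℝ (⊤ : ℕ∞) g (Ioi M)) (hψ : ContDiffOn ℝ (⊤ : ℕ∞) ψ (Ioi M))
    {f : ℝ → ℂ} (hf : ContDiffOn ℝ (⊤ : ℕ∞) f (Ioi M)) :
    ContDiffOn ℝ (⊤ : ℕ∞) (twistedDeriv g ψ f) (Ioi M) :=
  hg.mul ((ContDiffOn.deriv_Ioi hf).add (hψ.mul hf))

lemma contDiffOn_iterate_twistedDeriv (hg : ContDiffOn ℝ (⊤ : ℕ∞) g (Ioi M))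
    (hψ : ContDiffOn ℝ (⊤ : ℕ∞) ψ (Ioi M)) {f : ℝ → ℂ} (hf : ContDiffOn ℝ (⊤ : ℕ∞) f (Ioi M)) (n : ℕ) :
    ContDiffOn ℝ (⊤ : ℕ∞) ((twistedDeriv g ψ)^[n] f) (Ioi M) := by
  induction n with
  | zero => exact hf
  | succ n ih =>
    rw [Function.iterate_succ_apply']
    exact contDiffOn_twistedDeriv hg hψ ih

lemma twistedDeriv_eqOn {f f' : ℝ → ℂ} (h : EqOn f f' (Ioi M)) :
    EqOn (twistedDeriv g ψ f) (twistedDeriv g ψ f') (Ioi M) := fun r hr => by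
  simp only [twistedDeriv, deriv_eqOn_Ioi h hr, h hr]

lemma iterate_twistedDeriv_eqOn {f f' : ℝ → ℂ} (h : EqOn f f' (Ioi M)) (n : ℕ) :
    EqOn ((twistedDeriv g ψ)^[n] f) ((twistedDeriv g ψ)^[n] f') (Ioi M) := by
  induction n with
  | zero => exact h
  | succ n ih =>
    rw [Function.iterate_succ_apply', Function.iterate_succ_apply']
    exact twistedDeriv_eqOn ih

lemma twistedDeriv_mul {h f : ℝ → ℂ} (hh : ContDiffOn ℝ (⊤ : ℕ∞) h (Ioi M))
    (hf : ContDiffOn ℝ (⊤ : ℕ∞) f (Ioi M)) :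
    EqOn (twistedDeriv g ψ (fun r => h r * f r))
      (fun r => h r * twistedDeriv g ψ f r + g r * deriv h r * f r) (Ioi M) := fun r hr => by
  have := ((ContDiffOn.hasDerivAt_Ioi hh hr).mul (ContDiffOn.hasDerivAt_Ioi hf hr)).deriv
  simp only [twistedDeriv]
  rw [show (fun r => h r * f r) = h * f from rfl, this]
  ring

lemma twistedDeriv_add {f₁ f₂ : ℝ → ℂ} (hf₁ : ContDiffOn ℝ (⊤ : ℕ∞) f₁ (Ioi M))
    (hf₂ : ContDiffOn ℝ (⊤ : ℕ∞) f₂ (Ioi M)) :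
    EqOn (twistedDeriv g ψ (fun r => f₁ r + f₂ r))
      (fun r => twistedDeriv g ψ f₁ r + twistedDeriv g ψ f₂ r) (Ioi M) := fun r hr => by
  have := ((ContDiffOn.hasDerivAt_Ioi hf₁ hr).add (ContDiffOn.hasDerivAt_Ioi hf₂ hr)).deriv
  simp only [twistedDeriv]
  rw [show (fun r => f₁ r + f₂ r) = f₁ + f₂ from rfl, this]
  ring

/-- `Dⁿ⁺¹ x - x Dⁿ⁺¹ = (n + 1) Dⁿ` for `D = d/dr + ψ` and `x = r - M`. -/
lemma iterate_twistedDeriv_sub_mul (hψ : ContDiffOn ℝ (⊤ : ℕ∞) ψ (Ioi M)) {f : ℝ → ℂ}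
    (hf : ContDiffOn ℝ (⊤ : ℕ∞) f (Ioi M)) (n : ℕ) :
    EqOn ((twistedDeriv 1 ψ)^[n + 1] (fun r => ((r - M : ℝ) : ℂ) * f r))
      (fun r => ((r - M : ℝ) : ℂ) * (twistedDeriv 1 ψ)^[n + 1] f r
        + (n + 1) * (twistedDeriv 1 ψ)^[n] f r) (Ioi M) := by
  have h1 : ContDiffOn ℝ (⊤ : ℕ∞) (1 : ℝ → ℂ) (Ioi M) := contDiffOn_const
  have hx : ContDiffOn ℝ (⊤ : ℕ∞) (fun r : ℝ => ((r - M : ℝ) : ℂ)) (Ioi M) :=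
    (Complex.ofRealCLM.contDiff.comp (contDiff_id.sub contDiff_const)).contDiffOn
  have hdx : ∀ r : ℝ, deriv (fun r : ℝ => ((r - M : ℝ) : ℂ)) r = 1 := fun r => by
    simpa using (((hasDerivAt_id r).sub_const M).ofReal_comp).deriv
  have key : ∀ {f : ℝ → ℂ}, ContDiffOn ℝ (⊤ : ℕ∞) f (Ioi M) →
      EqOn (twistedDeriv 1 ψ (fun r => ((r - M : ℝ) : ℂ) * f r))
        (fun r => ((r - M : ℝ) : ℂ) * twistedDeriv 1 ψ f r + f r) (Ioi M) := fun hf r hr => by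
    rw [twistedDeriv_mul hx hf hr]; beta_reduce; rw [hdx]; simp
  induction n with
  | zero => simpa using key hf
  | succ n ih =>
    intro r hr
    have hs := contDiffOn_iterate_twistedDeriv h1 hψ hf
    rw [Function.iterate_succ_apply', twistedDeriv_eqOn ih hr,
      twistedDeriv_add (hx.mul (hs _)) (contDiffOn_const.mul (hs _)) hr]
    beta_reduce
    rw [key (hs _) hr, twistedDeriv_mul (h := fun _ => (n + 1 : ℂ)) contDiffOn_const (hs _) hr]
    simp only [← Function.iterate_succ_apply' (twistedDeriv 1 ψ), deriv_const]
    push_cast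
    ring

end TwistedDeriv

/-! ### Weighted square integrability of iterated derivatives -/

section Regularity

variable {M : ℝ} {S : Set ℝ} {g ψ w w₁ : ℝ → ℂ}

lemma memLp_two_of_le {E : Type*} [NormedAddCommGroup E] {f : ℝ → ℂ} {k : ℝ → E}
    (hS : MeasurableSet S) (hf : ContinuousOn f S) (C : ℝ)
    (hk : MemLp k 2 (volume.restrict S)) (h : ∀ r ∈ S, ‖f r‖ ≤ C * ‖k r‖) :
    MemLp f 2 (volume.restrict S) :=
  hk.of_le_mul (hf.aestronglyMeasurable hS) ((ae_restrict_iff' hS).2 (.of_forall h))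

lemma memLp_two_mul_of_bdd {f h : ℝ → ℂ} (hS : MeasurableSet S) (hh : ContinuousOn h S) (C : ℝ)
    (hC : ∀ r ∈ S, ‖h r‖ ≤ C) (hf : MemLp f 2 (volume.restrict S)) :
    MemLp (fun r => h r * f r) 2 (volume.restrict S) :=
  hf.of_le_mul ((hh.aestronglyMeasurable hS).mul hf.1) ((ae_restrict_iff' hS).2 (.of_forall
    fun r hr => by rw [norm_mul]; exact mul_le_mul_of_nonneg_right (hC r hr) (norm_nonneg _)))

lemma memLp_two_congr {f k : ℝ → ℂ} (hS : MeasurableSet S) (h : EqOn f k S)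
    (hk : MemLp k 2 (volume.restrict S)) : MemLp f 2 (volume.restrict S) :=
  (memLp_congr_ae ((ae_restrict_iff' hS).2 (.of_forall h))).2 hk

/-- `w Tʲ χ`, `j ≤ n`, and `w₁ Tⁿ⁺¹ χ` are square integrable on `S`. -/
def SquareIntegrableUpTo (T : (ℝ → ℂ) → ℝ → ℂ) (w w₁ : ℝ → ℂ) (S : Set ℝ) :
    ℕ → (ℝ → ℂ) → Prop
  | 0, χ => MemLp (fun r => w r * χ r) 2 (volume.restrict S) ∧
      MemLp (fun r => w₁ r * T χ r) 2 (volume.restrict S)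
  | n + 1, χ => MemLp (fun r => w r * χ r) 2 (volume.restrict S) ∧
      SquareIntegrableUpTo T w w₁ S n (T χ)

/-- Smooth functions all of whose derivatives along `g d/dr` are bounded on `S`. -/
structure IsBoundedMultiplier (M : ℝ) (g : ℝ → ℂ) (S : Set ℝ) (h : ℝ → ℂ) : Prop where
  smooth : ContDiffOn ℝ (⊤ : ℕ∞) h (Ioi M)
  bounded : ∀ n, ∃ C, ∀ r ∈ S, ‖((twistedDeriv g 0)^[n] h) r‖ ≤ C

lemma IsBoundedMultiplier.deriv (hg : ContDiffOn ℝ (⊤ : ℕ∞) g (Ioi M)) {h : ℝ → ℂ}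
    (hh : IsBoundedMultiplier M g S h) : IsBoundedMultiplier M g S (twistedDeriv g 0 h) :=
  ⟨contDiffOn_twistedDeriv hg contDiffOn_const hh.smooth, fun n => hh.bounded (n + 1)⟩

namespace SquareIntegrableUpTo

lemma of_iterate {T : (ℝ → ℂ) → ℝ → ℂ} {n : ℕ} {χ : ℝ → ℂ}
    (h : ∀ j ≤ n, MemLp (fun r => w r * T^[j] χ r) 2 (volume.restrict S))
    (h' : MemLp (fun r => w₁ r * T^[n + 1] χ r) 2 (volume.restrict S)) :
    SquareIntegrableUpTo T w w₁ S n χ := by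
  induction n generalizing χ with
  | zero => exact ⟨h 0 le_rfl, h'⟩
  | succ n ih => exact ⟨h 0 (Nat.zero_le _), ih (fun j hj => h (j + 1) (by omega)) h'⟩

lemma iterate {T : (ℝ → ℂ) → ℝ → ℂ} {n : ℕ} {χ : ℝ → ℂ}
    (h : SquareIntegrableUpTo T w w₁ S n χ) : SquareIntegrableUpTo T w w₁ S 0 (T^[n] χ) := by
  induction n generalizing χ with
  | zero => exact h
  | succ n ih => exact ih h.2

lemma congr (hS : MeasurableSet S) (hSM : S ⊆ Ioi M) {n : ℕ} {χ χ' : ℝ → ℂ}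
    (he : EqOn χ χ' (Ioi M)) (h : SquareIntegrableUpTo (twistedDeriv g ψ) w w₁ S n χ') :
    SquareIntegrableUpTo (twistedDeriv g ψ) w w₁ S n χ := by
  induction n generalizing χ χ' with
  | zero =>
    exact ⟨memLp_two_congr hS (fun r hr => by rw [he (hSM hr)]) h.1,
      memLp_two_congr hS (fun r hr => by rw [twistedDeriv_eqOn he (hSM hr)]) h.2⟩
  | succ n ih =>
    exact ⟨memLp_two_congr hS (fun r hr => by rw [he (hSM hr)]) h.1, ih (twistedDeriv_eqOn he) h.2⟩

lemma add (hS : MeasurableSet S) (hSM : S ⊆ Ioi M) (hg : ContDiffOn ℝ (⊤ : ℕ∞) g (Ioi M))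
    (hψ : ContDiffOn ℝ (⊤ : ℕ∞) ψ (Ioi M)) {n : ℕ} {χ χ' : ℝ → ℂ}
    (hχ : ContDiffOn ℝ (⊤ : ℕ∞) χ (Ioi M)) (hχ' : ContDiffOn ℝ (⊤ : ℕ∞) χ' (Ioi M))
    (h : SquareIntegrableUpTo (twistedDeriv g ψ) w w₁ S n χ)
    (h' : SquareIntegrableUpTo (twistedDeriv g ψ) w w₁ S n χ') :
    SquareIntegrableUpTo (twistedDeriv g ψ) w w₁ S n (fun r => χ r + χ' r) := by
  induction n generalizing χ χ' with
  | zero =>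
    refine ⟨memLp_two_congr hS (fun r hr => ?_) (h.1.add h'.1),
      memLp_two_congr hS (fun r hr => ?_) (h.2.add h'.2)⟩
    · simp [mul_add]
    · rw [twistedDeriv_add hχ hχ' (hSM hr)]; simp [mul_add]
  | succ n ih =>
    refine ⟨memLp_two_congr hS (fun r hr => ?_) (h.1.add h'.1),
      congr hS hSM (twistedDeriv_add hχ hχ') (ih (contDiffOn_twistedDeriv hg hψ hχ)
        (contDiffOn_twistedDeriv hg hψ hχ') h.2 h'.2)⟩
    simp [mul_add]

/-- The top-order term of level n is bounded by the zero-order term of level n + 1, since `w₁` is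
dominated by `w`. -/
lemma of_succ (hS : MeasurableSet S) (hSM : S ⊆ Ioi M) (hg : ContDiffOn ℝ (⊤ : ℕ∞) g (Ioi M))
    (hψ : ContDiffOn ℝ (⊤ : ℕ∞) ψ (Ioi M)) (hw₁ : ContinuousOn w₁ S)
    {C : ℝ} (hC : ∀ r ∈ S, ‖w₁ r‖ ≤ C * ‖w r‖) {n : ℕ} {χ : ℝ → ℂ}
    (hχ : ContDiffOn ℝ (⊤ : ℕ∞) χ (Ioi M))
    (h : SquareIntegrableUpTo (twistedDeriv g ψ) w w₁ S (n + 1) χ) :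
    SquareIntegrableUpTo (twistedDeriv g ψ) w w₁ S n χ := by
  induction n generalizing χ with
  | zero =>
    refine ⟨h.1, memLp_two_of_le hS
      (hw₁.mul ((contDiffOn_twistedDeriv hg hψ hχ).continuousOn.mono hSM)) C h.2.1 fun r hr => ?_⟩
    rw [norm_mul, norm_mul, ← mul_assoc]
    exact mul_le_mul_of_nonneg_right (hC r hr) (norm_nonneg _)
  | succ n ih => exact ⟨h.1, ih (contDiffOn_twistedDeriv hg hψ hχ) h.2⟩

lemma mono_zero (hS : MeasurableSet S) (hSM : S ⊆ Ioi M) (hg : ContDiffOn ℝ (⊤ : ℕ∞) g (Ioi M))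
    (hψ : ContDiffOn ℝ (⊤ : ℕ∞) ψ (Ioi M)) (hw₁ : ContinuousOn w₁ S)
    {C : ℝ} (hC : ∀ r ∈ S, ‖w₁ r‖ ≤ C * ‖w r‖) {n : ℕ} {χ : ℝ → ℂ}
    (hχ : ContDiffOn ℝ (⊤ : ℕ∞) χ (Ioi M)) (h : SquareIntegrableUpTo (twistedDeriv g ψ) w w₁ S n χ) :
    SquareIntegrableUpTo (twistedDeriv g ψ) w w₁ S 0 χ := by
  induction n with
  | zero => exact h
  | succ n ih => exact ih (of_succ hS hSM hg hψ hw₁ hC hχ h)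

/-- Leibniz rule: T(hχ) = h Tχ + (g h') χ, and both coefficients are again bounded multipliers. The
second summand has one derivative fewer on χ, so the induction on n must run over all h and χ. -/
lemma mul (hS : MeasurableSet S) (hSM : S ⊆ Ioi M) (hg : ContDiffOn ℝ (⊤ : ℕ∞) g (Ioi M))
    (hψ : ContDiffOn ℝ (⊤ : ℕ∞) ψ (Ioi M)) (hw : ContinuousOn w S) (hw₁ : ContinuousOn w₁ S)
    {C : ℝ} (hC : ∀ r ∈ S, ‖w₁ r‖ ≤ C * ‖w r‖) {n : ℕ} {χ h : ℝ → ℂ}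
    (hχ : ContDiffOn ℝ (⊤ : ℕ∞) χ (Ioi M)) (hh : IsBoundedMultiplier M g S h)
    (hP : SquareIntegrableUpTo (twistedDeriv g ψ) w w₁ S n χ) :
    SquareIntegrableUpTo (twistedDeriv g ψ) w w₁ S n (fun r => h r * χ r) := by
  have hT : ∀ {χ h : ℝ → ℂ}, ContDiffOn ℝ (⊤ : ℕ∞) χ (Ioi M) → ContDiffOn ℝ (⊤ : ℕ∞) h (Ioi M) →
      EqOn (twistedDeriv g ψ (fun r => h r * χ r))
        (fun r => h r * twistedDeriv g ψ χ r + twistedDeriv g 0 h r * χ r) (Ioi M) :=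
    fun hχ hh r hr => by rw [twistedDeriv_mul hh hχ hr]; simp [twistedDeriv]
  have hc := fun {f : ℝ → ℂ} (hf : ContDiffOn ℝ (⊤ : ℕ∞) f (Ioi M)) => hf.continuousOn.mono hSM
  have h0 : ∀ {v f h : ℝ → ℂ}, ContinuousOn v S → ContDiffOn ℝ (⊤ : ℕ∞) f (Ioi M) →
      IsBoundedMultiplier M g S h → MemLp (fun r => v r * f r) 2 (volume.restrict S) →
      MemLp (fun r => v r * (h r * f r)) 2 (volume.restrict S) := fun hv hf hh hm => by
    obtain ⟨B, hB⟩ := hh.bounded 0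
    refine memLp_two_of_le hS (hv.mul ((hc hh.smooth).mul (hc hf))) B hm fun r hr => ?_
    rw [mul_left_comm, norm_mul]
    exact mul_le_mul_of_nonneg_right (hB r hr) (norm_nonneg _)
  induction n generalizing χ h with
  | zero =>
    have hB : MemLp (fun r => w₁ r * (twistedDeriv g 0 h r * χ r)) 2 (volume.restrict S) := by
      refine memLp_two_of_le hS (hw₁.mul ((hc (hh.deriv hg).smooth).mul (hc hχ))) C
        (h0 hw hχ (hh.deriv hg) hP.1) fun r hr => ?_
      rw [norm_mul, norm_mul (w r), ← mul_assoc]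
      exact mul_le_mul_of_nonneg_right (hC r hr) (norm_nonneg _)
    refine ⟨h0 hw hχ hh hP.1, memLp_two_congr hS (fun r hr => ?_)
      ((h0 hw₁ (contDiffOn_twistedDeriv hg hψ hχ) hh hP.2).add hB)⟩
    rw [hT hχ hh.smooth (hSM hr)]; simp [mul_add]
  | succ n ih =>
    have hTχ := contDiffOn_twistedDeriv hg hψ hχ
    have hδ := hh.deriv hg
    exact ⟨h0 hw hχ hh hP.1, congr hS hSM (hT hχ hh.smooth)
      (add hS hSM hg hψ (hh.smooth.mul hTχ) (hδ.smooth.mul hχ) (ih hTχ hh hP.2)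
        (ih hχ hδ (of_succ hS hSM hg hψ hw₁ hC hχ hP)))⟩

/-- Replacing the weight `g` of the derivative by `ρ g`. -/
lemma iterate_mul (hg : ContDiffOn ℝ (⊤ : ℕ∞) g (Ioi M)) (hψ : ContDiffOn ℝ (⊤ : ℕ∞) ψ (Ioi M))
    {n : ℕ} {χ ρ : ℝ → ℂ} (hχ : ContDiffOn ℝ (⊤ : ℕ∞) χ (Ioi M))
    (hρ : ContDiffOn ℝ (⊤ : ℕ∞) ρ (Ioi M))
    (hρP : ∀ n χ, ContDiffOn ℝ (⊤ : ℕ∞) χ (Ioi M) →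
      SquareIntegrableUpTo (twistedDeriv g ψ) w w₁ S n χ →
      SquareIntegrableUpTo (twistedDeriv g ψ) w w₁ S n (fun r => ρ r * χ r))
    (hP : SquareIntegrableUpTo (twistedDeriv g ψ) w w₁ S n χ) :
    SquareIntegrableUpTo (twistedDeriv g ψ) w w₁ S 0
      ((twistedDeriv (fun r => ρ r * g r) ψ)^[n] χ) := by
  induction n generalizing χ with
  | zero => exact hP
  | succ n ih =>
    have := hρP _ _ (contDiffOn_twistedDeriv hg hψ hχ) hP.2
    rw [show (fun r => ρ r * twistedDeriv g ψ χ r) = twistedDeriv (fun r => ρ r * g r) ψ χ from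
      funext fun r => by simp [twistedDeriv, mul_assoc]] at this
    exact ih (contDiffOn_twistedDeriv (hρ.mul hg) hψ hχ) this

end SquareIntegrableUpTo

end Regularity

/-! ### Real powers of r - M -/

/-- `(r - M)ᵗ` as a complex-valued function. -/
def shiftPow (M t r : ℝ) : ℂ := (((r - M) ^ t : ℝ) : ℂ)

section ShiftPow

variable {M t r : ℝ}

lemma hasDerivAt_shiftPow (hr : M < r) :
    HasDerivAt (shiftPow M t) (t * shiftPow M (t - 1) r) r := by
  have h := ((hasDerivAt_id r).sub_const M).rpow_const (p := t) (Or.inl (sub_pos.2 hr).ne')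
  have := h.ofReal_comp
  simp only [one_mul, id, Complex.ofReal_mul] at this
  exact this

lemma shiftPow_add (s t : ℝ) (hr : M < r) :
    shiftPow M (s + t) r = shiftPow M s r * shiftPow M t r := by
  simp [shiftPow, Real.rpow_add (sub_pos.2 hr)]

lemma shiftPow_one (M r : ℝ) : shiftPow M 1 r = r - M := by simp [shiftPow]

lemma shiftPow_add_one (s : ℝ) (hr : M < r) :
    shiftPow M (s + 1) r = shiftPow M s r * (r - M) := by
  rw [shiftPow_add s 1 hr, shiftPow_one]

lemma shiftPow_sub_one (s : ℝ) (hr : M < r) :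
    shiftPow M s r = shiftPow M (s - 1) r * (r - M) := by
  rw [← shiftPow_add_one _ hr, sub_add_cancel]

lemma shiftPow_ne_zero (t : ℝ) (hr : M < r) : shiftPow M t r ≠ 0 := by
  simpa [shiftPow] using (Real.rpow_pos_of_pos (sub_pos.2 hr) t).ne'

lemma norm_shiftPow (t : ℝ) (hr : M < r) : ‖shiftPow M t r‖ = (r - M) ^ t := by
  rw [shiftPow, Complex.norm_real, Real.norm_of_nonneg (Real.rpow_nonneg (sub_pos.2 hr).le t)]

lemma contDiffOn_shiftPow (M t : ℝ) : ContDiffOn ℝ (⊤ : ℕ∞) (shiftPow M t) (Ioi M) :=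
  Complex.ofRealCLM.contDiff.comp_contDiffOn fun _ hr =>
    ((contDiff_id.sub contDiff_const).contDiffAt.rpow_const_of_ne
      (sub_pos.2 hr).ne').contDiffWithinAt

end ShiftPow

/-! ### The reduced equation and its ladder operators -/

/-- Classical solutions `u`, with `u' = p`, of the equation
`u'' + (ω² + (4 M ω² + 2 i ω σ) / (r - M) + q / (r - M)²) u = 0` on `(M, (⊤ : ℕ∞))`. -/
structure IsReducedSolution (M ω q σ : ℝ) (v : (ℝ → ℂ) × (ℝ → ℂ)) : Prop where
  hasDerivAt_fst : ∀ r, M < r → HasDerivAt v.1 (v.2 r) r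
  hasDerivAt_snd : ∀ r, M < r → HasDerivAt v.2
    (-(ω ^ 2 + (4 * M * ω ^ 2 + 2 * Complex.I * ω * σ) / (r - M) + q / (r - M) ^ 2) * v.1 r) r

/-- The first order operator raising the spin `σ` by one. The operator lowering it is
`raise M (-ω) q (-σ)`. -/
def raise (M ω q σ : ℝ) (v : (ℝ → ℂ) × (ℝ → ℂ)) : (ℝ → ℂ) × (ℝ → ℂ) :=
  (fun r => (r - M) * v.2 r + (σ - Complex.I * ω * (r + M)) * v.1 r,
    fun r => (σ + 1 - Complex.I * ω * (r + M)) * v.2 r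
      - ((r - M) * ω ^ 2 + (4 * M * ω ^ 2 + 2 * Complex.I * ω * σ) + q / (r - M)
        + Complex.I * ω) * v.1 r)

/-- Iterated raising, starting at spin `σ`. -/
def ladder (M ω q σ : ℝ) (v : (ℝ → ℂ) × (ℝ → ℂ)) : ℕ → (ℝ → ℂ) × (ℝ → ℂ)
  | 0 => v
  | j + 1 => raise M ω q (σ + j) (ladder M ω q σ v j)

namespace IsReducedSolution

variable {M ω q σ : ℝ} {v : (ℝ → ℂ) × (ℝ → ℂ)}

lemma neg (h : IsReducedSolution M ω q σ v) : IsReducedSolution M (-ω) q (-σ) v :=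
  ⟨h.1, fun r hr => by convert h.2 r hr using 1; push_cast; ring⟩

lemma of_neg (h : IsReducedSolution M (-ω) q (-σ) v) : IsReducedSolution M ω q σ v := by
  simpa using h.neg

lemma ofReal_sub_ne_zero {M r : ℝ} (hr : M < r) : (r - M : ℂ) ≠ 0 := by
  exact_mod_cast (sub_pos.2 hr).ne'

/-- In the variable z = 2iωx this is Whittaker's equation with κ = σ - 2iMω and with μ determined by
q. The operator is the classical one shifting κ by one at fixed μ. -/
lemma raise (h : IsReducedSolution M ω q σ v) :
    IsReducedSolution M ω q (σ + 1) (raise M ω q σ v) := by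
  have hx : ∀ r : ℝ, HasDerivAt (fun r : ℝ => (r - M : ℂ)) 1 r := fun r => by
    simpa using ((hasDerivAt_id r).ofReal_comp).sub_const (M : ℂ)
  have hy : ∀ (c : ℂ) (r : ℝ), HasDerivAt (fun r : ℝ => c - Complex.I * ω * (r + M))
      (-(Complex.I * ω)) r := fun c r => by
    simpa using ((((hasDerivAt_id r).ofReal_comp).add_const (M : ℂ)).const_mul
      (Complex.I * ω)).const_sub c
  refine ⟨fun r hr => ?_, fun r hr => ?_⟩
  · have h0 := ofReal_sub_ne_zero hr
    refine (((hx r).mul (h.2 r hr)).add ((hy σ r).mul (h.1 r hr))).congr_deriv ?_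
    simp only [KerrTeukolsky.raise]
    field_simp
    ring
  · have h0 := ofReal_sub_ne_zero hr
    refine (((hy (σ + 1) r).mul (h.2 r hr)).sub ((((((hx r).mul_const ((ω : ℂ) ^ 2)).add_const
      (4 * M * ω ^ 2 + 2 * Complex.I * ω * σ : ℂ)).add ((hasDerivAt_const r (q : ℂ)).div (hx r)
        h0)).add_const (Complex.I * ω)).mul (h.1 r hr))).congr_deriv ?_
    simp only [KerrTeukolsky.raise, Pi.add_apply, Pi.div_apply]
    push_cast
    field_simp
    ring_nf
    simp only [Complex.I_sq]
    ring

lemma ladder (h : IsReducedSolution M ω q σ v) (j : ℕ) :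
    IsReducedSolution M ω q (σ + j) (ladder M ω q σ v j) := by
  induction j with
  | zero => simpa [KerrTeukolsky.ladder] using h
  | succ j ih =>
    have := ih.raise
    rw [add_assoc] at this
    exact_mod_cast this

/-- Lowering after raising is multiplication by a constant. -/
lemma lower_raise (M ω q σ : ℝ) (v : (ℝ → ℂ) × (ℝ → ℂ)) {r : ℝ} (hr : M < r) :
    (KerrTeukolsky.raise M (-ω) q (-(σ + 1)) (KerrTeukolsky.raise M ω q σ v)).1 r
      = -(q + (2 * Complex.I * M * ω - σ) * (2 * Complex.I * M * ω - σ - 1)) * v.1 r := by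
  have h0 := ofReal_sub_ne_zero hr
  simp only [KerrTeukolsky.raise]
  push_cast
  field_simp
  ring_nf
  simp only [Complex.I_sq]
  ring

lemma contDiffOn (h : IsReducedSolution M ω q σ v) :
    ContDiffOn ℝ (⊤ : ℕ∞) v.1 (Ioi M) ∧ ContDiffOn ℝ (⊤ : ℕ∞) v.2 (Ioi M) := by
  have hx : ContDiffOn ℝ (⊤ : ℕ∞) (fun r : ℝ => (r - M : ℂ)) (Ioi M) := by
    have := Complex.ofRealCLM.contDiff (n := (⊤ : ℕ∞))
    exact (this.sub contDiff_const).contDiffOn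
  have hV : ContDiffOn ℝ (⊤ : ℕ∞) (fun r : ℝ => -((ω : ℂ) ^ 2 + (4 * M * ω ^ 2 + 2 * Complex.I * ω * σ)
      / (r - M) + q / (r - M) ^ 2)) (Ioi M) := by
    simp only [div_eq_mul_inv]
    exact ((contDiffOn_const.add (contDiffOn_const.mul (hx.inv fun _ hr =>
      ofReal_sub_ne_zero hr))).add (contDiffOn_const.mul ((hx.pow 2).inv fun _ hr =>
        pow_ne_zero 2 (ofReal_sub_ne_zero hr)))).neg
  -- Bootstrap: u' = p and p' is a smooth multiple of u, so each order of regularity of the pair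
  -- gives the next.
  have key : ∀ n : ℕ, ContDiffOn ℝ n v.1 (Ioi M) ∧ ContDiffOn ℝ n v.2 (Ioi M) := fun n => by
    induction n with
    | zero =>
      simp only [Nat.cast_zero, contDiffOn_zero]
      exact ⟨fun r hr => (h.1 r hr).continuousAt.continuousWithinAt,
        fun r hr => (h.2 r hr).continuousAt.continuousWithinAt⟩
    | succ n ih =>
      push_cast
      rw [contDiffOn_succ_iff_deriv_of_isOpen isOpen_Ioi,
        contDiffOn_succ_iff_deriv_of_isOpen isOpen_Ioi]
      refine ⟨⟨fun r hr => (h.1 r hr).differentiableAt.differentiableWithinAt, by simp, ?_⟩,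
        ⟨fun r hr => (h.2 r hr).differentiableAt.differentiableWithinAt, by simp, ?_⟩⟩
      · exact ih.2.congr fun r hr => (h.1 r hr).deriv
      · exact ((hV.of_le (by exact_mod_cast le_top)).mul ih.1).congr fun r hr => (h.2 r hr).deriv
  exact ⟨contDiffOn_infty.2 fun n => (key n).1, contDiffOn_infty.2 fun n => (key n).2⟩

variable {ψ : ℝ → ℂ}

/-- `D ((r - M)ᵗ u)` in terms of `u` and `u' = p`, for `D = d/dr - iω (r + M) / (r - M)`. -/
lemma twistedDeriv_shiftPow_mul (h : IsReducedSolution M ω q σ v) (g : ℝ → ℂ)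
    (hψ : ∀ r, M < r → ψ r = -(Complex.I * ω * (r + M) / (r - M))) (t : ℝ) {r : ℝ} (hr : M < r) :
    twistedDeriv g ψ (fun r => shiftPow M t r * v.1 r) r = g r * (shiftPow M (t - 1) r *
      ((r - M) * v.2 r + (t - Complex.I * ω * (r + M)) * v.1 r)) := by
  have h0 := ofReal_sub_ne_zero hr
  rw [twistedDeriv, ((hasDerivAt_shiftPow hr).fun_mul (h.1 r hr)).deriv, hψ r hr,
    shiftPow_sub_one t hr]
  field_simp
  ring

/-- Conjugated by the power x^σ, the operator x² D is spin raising; each application also raises the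
power by one, matching the new spin. -/
lemma iterate_twistedDeriv_shiftPow (h : IsReducedSolution M ω q σ v)
    (hψ : ∀ r, M < r → ψ r = -(Complex.I * ω * (r + M) / (r - M))) (n : ℕ) :
    EqOn ((twistedDeriv (fun r => (r - M) ^ 2) ψ)^[n] (fun r => shiftPow M σ r * v.1 r))
      (fun r => shiftPow M (σ + n) r * (KerrTeukolsky.ladder M ω q σ v n).1 r) (Ioi M) := by
  induction n with
  | zero => intro r _; simp [KerrTeukolsky.ladder]
  | succ n ih =>
    intro r hr
    rw [Function.iterate_succ_apply', twistedDeriv_eqOn ih hr,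
      (h.ladder n).twistedDeriv_shiftPow_mul _ hψ _ hr, Nat.cast_succ, ← add_assoc]
    beta_reduce
    rw [shiftPow_add_one _ hr, shiftPow_sub_one (σ + n) hr]
    simp only [KerrTeukolsky.ladder, KerrTeukolsky.raise]
    push_cast
    ring

end IsReducedSolution

/-! ### A Bol-type identity -/

/-- `Dⁿ (xⁿ⁻¹ f) = x⁻ⁿ⁻¹ (x² D)ⁿ f` for `D = d/dr + ψ` and `x = r - M`. -/
lemma iterate_twistedDeriv_bol {M : ℝ} {ψ f : ℝ → ℂ} (hψ : ContDiffOn ℝ (⊤ : ℕ∞) ψ (Ioi M))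
    (hf : ContDiffOn ℝ (⊤ : ℕ∞) f (Ioi M)) (n : ℕ) :
    EqOn ((twistedDeriv 1 ψ)^[n] (fun r => shiftPow M (n - 1) r * f r))
      (fun r => shiftPow M (-n - 1) r * (twistedDeriv (fun r => (r - M) ^ 2) ψ)^[n] f r)
      (Ioi M) := by
  induction n with
  | zero => intro r _; simp
  | succ n ih =>
    intro r hr
    have hx2 : ContDiffOn ℝ (⊤ : ℕ∞) (fun r : ℝ => (r - M : ℂ) ^ 2) (Ioi M) := by
      have := Complex.ofRealCLM.contDiff (n := (⊤ : ℕ∞))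
      exact ((this.sub contDiff_const).pow 2).contDiffOn
    have hG := (contDiffOn_shiftPow M (n - 1)).mul hf
    have hH := contDiffOn_iterate_twistedDeriv hx2 hψ hf n
    have e : EqOn (fun r => shiftPow M ((n + 1 : ℕ) - 1) r * f r)
        (fun r => ((r - M : ℝ) : ℂ) * (shiftPow M (n - 1) r * f r)) (Ioi M) := fun r hr => by
      have : ((n + 1 : ℕ) : ℝ) - 1 = (n - 1) + 1 := by push_cast; ring
      simp only [this, shiftPow_add_one _ hr]
      push_cast; ring
    rw [iterate_twistedDeriv_eqOn e _ hr, iterate_twistedDeriv_sub_mul hψ hG n hr]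
    beta_reduce
    rw [Function.iterate_succ_apply', twistedDeriv_eqOn ih hr, ih hr,
      twistedDeriv_mul (contDiffOn_shiftPow M _) hH hr, Function.iterate_succ_apply']
    beta_reduce
    rw [(hasDerivAt_shiftPow hr).deriv]
    have e1 : shiftPow M (-n - 1) r = shiftPow M (-n - 1 - 1) r * (r - M) := shiftPow_sub_one _ hr
    have e2 : shiftPow M (-((n + 1 : ℕ) : ℝ) - 1) r = shiftPow M (-n - 1 - 1) r := by
      congr 1; push_cast; ring
    simp only [e1, e2, twistedDeriv, Pi.one_apply]
    push_cast
    ring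

/-! ### Uniqueness: growth at infinity and the conserved current -/

namespace IsReducedSolution

variable {M ω q σ t : ℝ} {v U W : (ℝ → ℂ) × (ℝ → ℂ)}

/-- Growth estimate: a solution of spin `t` which, together with its derivative, is
`o((r - M)^(-t))` in the mean square sense vanishes. -/
lemma eq_zero_of_memLp_Ioi (hM : 0 ≤ M) (hω : ω ≠ 0) (ht : 0 ≤ t)
    (h : IsReducedSolution M ω q t v) {r₀ : ℝ} (hr₀ : M < r₀)
    (hu : MemLp (fun r => shiftPow M t r * v.1 r) 2 (volume.restrict (Ioi r₀)))
    (hp : MemLp (fun r => shiftPow M t r * v.2 r) 2 (volume.restrict (Ioi r₀))) :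
    ∀ r, M < r → v.1 r = 0 := by
  set Q : ℝ → ℝ := fun r => ω ^ 2 + 4 * M * ω ^ 2 / (r - M) with hQ
  set E : ℝ → ℝ := fun r => ‖v.2 r‖ ^ 2 + Q r * ‖v.1 r‖ ^ 2 with hE
  -- By 2|ω||u||u'| ≤ E, the spin term costs E' at most (2t/x) E, which the factor x^(2t) in G
  -- compensates exactly. C collects the O(x⁻²) losses, from q and from the derivative of Q.
  set C : ℝ := |q| / |ω| + 4 * M with hC
  set G : ℝ → ℝ := fun r => (r - M) ^ (2 * t) * Real.exp (-(C / (r - M))) * E r with hG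
  have hQ0 : ∀ r, M < r → ω ^ 2 ≤ Q r := fun r hr => by
    have : 0 < r - M := sub_pos.2 hr
    simp only [hQ]
    have : 0 ≤ 4 * M * ω ^ 2 / (r - M) := by positivity
    linarith
  have hωpos : 0 < |ω| := abs_pos.2 hω
  have hω2 : ω ^ 2 = |ω| ^ 2 := (sq_abs ω).symm
  have hE0 : ∀ r, M < r → 2 * |ω| * (‖v.2 r‖ * ‖v.1 r‖) ≤ E r := fun r hr => by
    have h1 := mul_le_mul_of_nonneg_right (hQ0 r hr) (sq_nonneg ‖v.1 r‖)
    simp only [hE]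
    rw [hω2] at h1
    nlinarith [sq_nonneg (‖v.2 r‖ - |ω| * ‖v.1 r‖)]
  have hE1 : ∀ r, M < r → ω ^ 2 * ‖v.1 r‖ ^ 2 ≤ E r := fun r hr => by
    have h1 := mul_le_mul_of_nonneg_right (hQ0 r hr) (sq_nonneg ‖v.1 r‖)
    simp only [hE]
    nlinarith [sq_nonneg ‖v.2 r‖]
  have hEnn : ∀ r, M < r → 0 ≤ E r := fun r hr => le_trans (by positivity) (hE1 r hr)
  have hE' : ∀ r, M < r → ∃ e, HasDerivAt E e r ∧
      0 ≤ e + (2 * t / (r - M) + C / (r - M) ^ 2) * E r := fun r hr => by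
    have hx : 0 < r - M := sub_pos.2 hr
    have hQd : HasDerivAt Q (-(4 * M * ω ^ 2 / (r - M) ^ 2)) r := by
      refine (((hasDerivAt_const r (4 * M * ω ^ 2)).fun_div ((hasDerivAt_id' r).sub_const M)
        hx.ne').const_add (ω ^ 2)).congr_deriv ?_
      ring
    refine ⟨_, (h.2 r hr).norm_sq.fun_add (hQd.fun_mul (h.1 r hr).norm_sq), ?_⟩
    set c : ℂ := 2 * Complex.I * ω * t / (r - M) + q / (r - M) ^ 2 with hc
    have hcn : ‖c‖ ≤ 2 * |ω| * t / (r - M) + |q| / (r - M) ^ 2 := by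
      refine (norm_add_le _ _).trans (le_of_eq ?_)
      have : ‖(r - M : ℂ)‖ = r - M := by
        rw [← Complex.ofReal_sub, Complex.norm_real, Real.norm_of_nonneg hx.le]
      simp [this, abs_of_nonneg ht]
    have hdec : -((ω : ℂ) ^ 2 + (4 * M * ω ^ 2 + 2 * Complex.I * ω * t) / (r - M)
        + q / (r - M) ^ 2) * v.1 r = (-(Q r)) • v.1 r - c * v.1 r := by
      simp only [hc, hQ, Complex.real_smul]
      push_cast
      ring
    have hin : inner ℝ (v.2 r) (c * v.1 r) ≤ ‖v.2 r‖ * (‖c‖ * ‖v.1 r‖) := by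
      rw [← norm_mul]; exact real_inner_le_norm _ _
    rw [hdec, inner_sub_right, inner_smul_right, real_inner_comm (v.1 r)]
    have h1 : ‖v.2 r‖ * (‖c‖ * ‖v.1 r‖) ≤
        (2 * |ω| * t / (r - M) + |q| / (r - M) ^ 2) * (‖v.2 r‖ * ‖v.1 r‖) := by
      rw [mul_left_comm]
      exact mul_le_mul_of_nonneg_right hcn (by positivity)
    have h2 : 2 * ((2 * |ω| * t / (r - M) + |q| / (r - M) ^ 2) * (‖v.2 r‖ * ‖v.1 r‖)) =
        (2 * t / (r - M) + |q| / |ω| / (r - M) ^ 2) * (2 * |ω| * (‖v.2 r‖ * ‖v.1 r‖)) := by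
      field_simp
    have h3 : (2 * t / (r - M) + |q| / |ω| / (r - M) ^ 2) * (2 * |ω| * (‖v.2 r‖ * ‖v.1 r‖)) ≤
        (2 * t / (r - M) + |q| / |ω| / (r - M) ^ 2) * E r :=
      mul_le_mul_of_nonneg_left (hE0 r hr) (by positivity)
    have h4 : 4 * M * ω ^ 2 / (r - M) ^ 2 * ‖v.1 r‖ ^ 2 ≤ 4 * M / (r - M) ^ 2 * E r := by
      calc 4 * M * ω ^ 2 / (r - M) ^ 2 * ‖v.1 r‖ ^ 2
          = 4 * M / (r - M) ^ 2 * (ω ^ 2 * ‖v.1 r‖ ^ 2) := by ring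
        _ ≤ _ := mul_le_mul_of_nonneg_left (hE1 r hr) (by positivity)
    have h5 : C / (r - M) ^ 2 * E r =
        |q| / |ω| / (r - M) ^ 2 * E r + 4 * M / (r - M) ^ 2 * E r := by rw [hC]; ring
    linarith
  have hmono : MonotoneOn G (Ioi M) := by
    have hd : ∀ r, M < r → ∃ e, HasDerivAt G e r ∧ 0 ≤ e := fun r hr => by
      have hx : 0 < r - M := sub_pos.2 hr
      obtain ⟨e, he, he0⟩ := hE' r hr
      have hpw := ((hasDerivAt_id' r).sub_const M).rpow_const (p := 2 * t) (Or.inl hx.ne')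
      have hex := (((hasDerivAt_const r C).fun_div ((hasDerivAt_id' r).sub_const M)
        hx.ne').fun_neg).exp
      refine ⟨_, (hpw.fun_mul hex).fun_mul he, ?_⟩
      have e1 : (r - M) ^ (2 * t) = (r - M) ^ (2 * t - 1) * (r - M) := by
        rw [← Real.rpow_add_one hx.ne', sub_add_cancel]
      have : 0 ≤ (r - M) ^ (2 * t) * Real.exp (-(C / (r - M))) *
        (e + (2 * t / (r - M) + C / (r - M) ^ 2) * E r) := by positivity
      refine this.trans (le_of_eq ?_)
      rw [e1]
      field_simp
      ring
    refine monotoneOn_of_deriv_nonneg (convex_Ioi M) (fun r hr => ?_) (fun r hr => ?_)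
      (fun r hr => ?_)
    · obtain ⟨e, he, -⟩ := hd r hr
      exact he.continuousAt.continuousWithinAt
    · rw [interior_Ioi] at hr
      obtain ⟨e, he, -⟩ := hd r hr
      exact he.differentiableAt.differentiableWithinAt
    · rw [interior_Ioi] at hr
      obtain ⟨e, he, he0⟩ := hd r hr
      rwa [he.deriv]
  intro r₁ hr₁
  by_contra hne
  have hG1 : 0 < G r₁ := by
    have hx : 0 < r₁ - M := sub_pos.2 hr₁
    have : 0 < E r₁ := lt_of_lt_of_le (by positivity) (hE1 r₁ hr₁)
    simp only [hG]
    positivity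
  -- Beyond r₁ the monotone G stays above its positive value there. Dropping the exponential and
  -- freezing the decreasing Q at r₀ bounds G by the two given integrable densities.
  have hlow : ∀ r, r₁ < r → r₀ < r →
      G r₁ ≤ ‖shiftPow M t r * v.2 r‖ ^ 2 + Q r₀ * ‖shiftPow M t r * v.1 r‖ ^ 2 := by
    intro r hr hr'
    have hMr := hr₁.trans hr
    have hx : 0 < r - M := sub_pos.2 hMr
    have hx0 : 0 < r₀ - M := sub_pos.2 hr₀
    have hpw : (r - M) ^ (2 * t) = ((r - M) ^ t) ^ 2 := by
      rw [mul_comm, Real.rpow_mul hx.le, Real.rpow_two]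
    have hCnn : 0 ≤ C / (r - M) := by positivity
    have hQle : Q r ≤ Q r₀ := by
      simp only [hQ]
      gcongr
    rw [norm_mul, norm_mul, mul_pow, mul_pow, norm_shiftPow t hMr, ← hpw]
    calc G r₁ ≤ G r := hmono hr₁ hMr hr.le
      _ ≤ (r - M) ^ (2 * t) * 1 * E r := by
        have := hEnn r hMr
        simp only [hG]
        gcongr
        exact Real.exp_le_one_iff.2 (by linarith)
      _ ≤ (r - M) ^ (2 * t) * 1 * (‖v.2 r‖ ^ 2 + Q r₀ * ‖v.1 r‖ ^ 2) := by
        simp only [hE]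
        gcongr
      _ = _ := by ring
  have hint : IntegrableOn (fun _ : ℝ => G r₁) (Ioi (max r₀ r₁)) := by
    have hsub : Ioi (max r₀ r₁) ⊆ Ioi r₀ := Ioi_subset_Ioi (le_max_left _ _)
    have := ((hp.integrable_norm_pow two_ne_zero).add
      ((hu.integrable_norm_pow two_ne_zero).const_mul (Q r₀)))
    refine Integrable.mono' (IntegrableOn.mono_set this hsub) aestronglyMeasurable_const
      ((ae_restrict_iff' measurableSet_Ioi).2 (.of_forall fun r hr => ?_))
    rw [Real.norm_of_nonneg hG1.le]
    exact hlow r ((le_max_right _ _).trans_lt hr) ((le_max_left _ _).trans_lt hr)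
  rcases (integrableOn_const_iff (by simp)).1 hint with h0 | h0
  · exact hG1.ne' (by simpa using h0)
  · simp at h0

/-- The conserved current of a pair of solutions of opposite spins. -/
lemma exists_wronskian_eq (hU : IsReducedSolution M ω q t U) (hW : IsReducedSolution M ω q (-t) W) :
    ∃ c : ℂ, ∀ r, M < r → U.1 r * star (W.2 r) - U.2 r * star (W.1 r) = c := by
  have hd : ∀ r, M < r →
      HasDerivAt (fun r => U.1 r * star (W.2 r) - U.2 r * star (W.1 r)) 0 r := fun r hr => by
    refine (((hU.1 r hr).fun_mul (hW.2 r hr).star).fun_sub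
      ((hU.2 r hr).fun_mul (hW.1 r hr).star)).congr_deriv ?_
    -- Conjugation flips the sign of 2iωσ and fixes the other coefficients, so the spin -t potential
    -- becomes the spin t one.
    simp only [star_mul', star_neg, star_add, star_div₀, star_pow, star_sub,
      Complex.star_def, Complex.conj_ofReal, Complex.conj_I, map_ofNat]
    push_cast
    ring
  obtain ⟨c, hc⟩ := isOpen_Ioi.exists_is_const_of_deriv_eq_zero isPreconnected_Ioi
    (fun r hr => (hd r hr).differentiableAt.differentiableWithinAt) (fun r hr => (hd r hr).deriv)
  exact ⟨c, hc⟩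

/-- The weights pair to x⁻¹, so c/x is a combination of products of square integrable functions and
hence integrable, whereas 1/x is not integrable at the horizon. -/
lemma wronskian_eq_zero (hU : IsReducedSolution M ω q t U) (hW : IsReducedSolution M ω q (-t) W)
    {δ : ℝ} (hδ : 0 < δ)
    (hU₁ : MemLp (fun r => shiftPow M (t - 1) r * U.1 r) 2 (volume.restrict (Ioc M (M + δ))))
    (hU₂ : MemLp (fun r => shiftPow M t r * U.2 r) 2 (volume.restrict (Ioc M (M + δ))))
    (hW₁ : MemLp (fun r => shiftPow M (-t - 1) r * W.1 r) 2 (volume.restrict (Ioc M (M + δ))))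
    (hW₂ : MemLp (fun r => shiftPow M (-t) r * W.2 r) 2 (volume.restrict (Ioc M (M + δ)))) :
    ∀ r, M < r → U.1 r * star (W.2 r) - U.2 r * star (W.1 r) = 0 := by
  obtain ⟨c, hc⟩ := exists_wronskian_eq hU hW
  suffices c = 0 by simpa [this] using hc
  by_contra hne
  have h1 := (hU₁.integrable_mul hW₂.star).sub (hU₂.integrable_mul hW₁.star)
  have h2 : IntegrableOn (fun r => (r - M)⁻¹) (Ioc M (M + δ)) := by
    refine (h1.norm.const_mul ‖c‖⁻¹).congr ((ae_restrict_iff' measurableSet_Ioc).2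
      (.of_forall fun r hr => ?_))
    have hr := hr.1
    have e1 : shiftPow M (t - 1) r * shiftPow M (-t) r = shiftPow M (-1) r := by
      rw [← shiftPow_add _ _ hr]; congr 1; ring
    have e2 : shiftPow M t r * shiftPow M (-t - 1) r = shiftPow M (-1) r := by
      rw [← shiftPow_add _ _ hr]; congr 1; ring
    have e3 : ∀ s, star (shiftPow M s r) = shiftPow M s r := fun s => by simp [shiftPow]
    have e4 : shiftPow M (t - 1) r * U.1 r * star (shiftPow M (-t) r * W.2 r)
        - shiftPow M t r * U.2 r * star (shiftPow M (-t - 1) r * W.1 r)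
        = shiftPow M (-1) r * c := by
      rw [star_mul', star_mul', e3, e3, ← hc r hr, mul_sub]
      linear_combination (U.1 r * star (W.2 r)) * e1 - (U.2 r * star (W.1 r)) * e2
    simp only [Pi.sub_apply, Pi.mul_apply, Pi.star_apply]
    rw [e4, norm_mul, norm_shiftPow _ hr, Real.rpow_neg_one, mul_left_comm,
      inv_mul_cancel₀ (norm_ne_zero_iff.2 hne), mul_one]
  have h3 : IntervalIntegrable (fun r => (r - M)⁻¹) volume M (M + δ) :=
    (intervalIntegrable_iff_integrableOn_Ioc_of_le (by linarith)).2 h2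
  rw [intervalIntegrable_sub_inv_iff] at h3
  rcases h3 with h3 | h3
  · linarith
  · exact h3 left_mem_uIcc

/-- `u' - iω (r + M) / (r - M) u`, the derivative along outgoing null directions. -/
def outDeriv (M ω : ℝ) (v : (ℝ → ℂ) × (ℝ → ℂ)) (r : ℝ) : ℂ :=
  v.2 r - Complex.I * ω * (r + M) / (r - M) * v.1 r

/-- Lowering G gives x times its outgoing derivative, plus 2iω(r + M) G, plus a constant times G;
only 2iωxG fails to be an error. The outgoing derivative of the lowered solution needs no second
derivative of G: raising it back returns a constant times G. -/
lemma memLp_lower_ladder {r₀ : ℝ} (hr₀ : M < r₀)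
    (h₁ : MemLp (fun r => shiftPow M (t - 1) r * v.1 r) 2 (volume.restrict (Ioi r₀)))
    (h₂ : MemLp (fun r => shiftPow M t r * outDeriv M ω v r) 2 (volume.restrict (Ioi r₀)))
    (n : ℕ) :
    MemLp (fun r => shiftPow M (t - n) r * (KerrTeukolsky.ladder M (-ω) q (-t) v n).1 r
      - (2 * Complex.I * ω) ^ n * (shiftPow M t r * v.1 r)) 2 (volume.restrict (Ioi r₀)) ∧
    MemLp (fun r => shiftPow M (t - n - 1) r * (KerrTeukolsky.ladder M (-ω) q (-t) v n).1 r) 2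
      (volume.restrict (Ioi r₀)) ∧
    MemLp (fun r => shiftPow M (t - n) r *
      outDeriv M ω (KerrTeukolsky.ladder M (-ω) q (-t) v n) r) 2 (volume.restrict (Ioi r₀)) := by
  have hinv : ∀ {f : ℝ → ℂ}, MemLp f 2 (volume.restrict (Ioi r₀)) →
      MemLp (fun r => shiftPow M (-1) r * f r) 2 (volume.restrict (Ioi r₀)) := fun hf => by
    refine memLp_two_mul_of_bdd measurableSet_Ioi
      ((contDiffOn_shiftPow M (-1)).continuousOn.mono (Ioi_subset_Ioi hr₀.le)) (r₀ - M)⁻¹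
      (fun r hr => ?_) hf
    rw [norm_shiftPow _ (hr₀.trans hr), Real.rpow_neg_one]
    exact inv_anti₀ (sub_pos.2 hr₀) (sub_le_sub_right (le_of_lt hr) M)
  induction n with
  | zero => simpa [KerrTeukolsky.ladder] using ⟨h₁, h₂⟩
  | succ n ih =>
    obtain ⟨ha, hb, hc⟩ := ih
    set G := KerrTeukolsky.ladder M (-ω) q (-t) v n with hG
    have hG' : KerrTeukolsky.ladder M (-ω) q (-t) v (n + 1) =
      KerrTeukolsky.raise M (-ω) q (-t + n) G := rfl
    rw [hG']
    set G' := KerrTeukolsky.raise M (-ω) q (-t + n) G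
    have e1 : ∀ r, M < r → shiftPow M (t - (n + 1 : ℕ)) r = shiftPow M (t - n - 1) r :=
      fun r hr => by congr 1; push_cast; ring
    have e2 : ∀ r, M < r → shiftPow M (t - n) r = shiftPow M (t - n - 1) r * (r - M) :=
      fun r hr => shiftPow_sub_one _ hr
    have ha' : MemLp (fun r => shiftPow M (t - (n + 1 : ℕ)) r * G'.1 r
        - (2 * Complex.I * ω) ^ (n + 1) * (shiftPow M t r * v.1 r)) 2
        (volume.restrict (Ioi r₀)) := by
      refine memLp_two_congr measurableSet_Ioi (fun r hr => ?_)
        ((hc.add (ha.const_mul (2 * Complex.I * ω))).add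
          (hb.const_mul (4 * Complex.I * ω * M + (-t + n))))
      have hr := hr₀.trans hr
      have h0 := ofReal_sub_ne_zero hr
      simp only [Pi.add_apply, G', KerrTeukolsky.raise, outDeriv]
      rw [e1 r hr, e2 r hr, pow_succ]
      push_cast
      field_simp
      ring
    have hb' : MemLp (fun r => shiftPow M (t - (n + 1 : ℕ) - 1) r * G'.1 r) 2
        (volume.restrict (Ioi r₀)) := by
      refine memLp_two_congr measurableSet_Ioi (fun r hr => ?_)
        ((hinv ha').add (h₁.const_mul ((2 * Complex.I * ω) ^ (n + 1))))
      have hr := hr₀.trans hr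
      simp only [Pi.add_apply]
      rw [sub_eq_add_neg _ (1 : ℝ), shiftPow_add _ _ hr, sub_eq_add_neg t 1,
        shiftPow_add _ _ hr]
      ring
    refine ⟨ha', hb', ?_⟩
    refine memLp_two_congr measurableSet_Ioi (fun r hr => ?_)
      ((hb'.const_mul (-t + n + 1)).add ((hinv hb).const_mul
        (-(q + (2 * Complex.I * M * (-ω : ℝ) - (-t + n : ℝ))
          * (2 * Complex.I * M * (-ω : ℝ) - (-t + n : ℝ) - 1)))))
    have hr := hr₀.trans hr
    have h0 := ofReal_sub_ne_zero hr
    have key := lower_raise M (-ω) q (-t + n) G hr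
    rw [KerrTeukolsky.raise] at key
    simp only [Pi.add_apply, outDeriv]
    have e3 : shiftPow M (t - (n + 1 : ℕ)) r = shiftPow M (t - (n + 1 : ℕ) - 1) r * (r - M) :=
      shiftPow_sub_one _ hr
    have e4 : shiftPow M (-1) r * shiftPow M (t - n - 1) r
        = shiftPow M (t - (n + 1 : ℕ) - 1) r := by
      rw [← shiftPow_add _ _ hr]; congr 1; push_cast; ring
    rw [e3, ← mul_assoc (shiftPow M (-1) r), e4, mul_left_comm _ (shiftPow M _ r) (G.1 r), ← key]
    change _ = _ + _ * ((r - M) * G'.2 r + _ * G'.1 r)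
    push_cast
    field_simp
    ring

/-- A pair of solutions of opposite spins related by lowering which is regular at the horizon and
outgoing at infinity is trivial. -/
theorem eq_zero_of_regular (hM : 0 ≤ M) (hω : ω ≠ 0) {n : ℕ} (hn : (n : ℝ) = 2 * t)
    (hU : IsReducedSolution M ω q t U) {δ r₀ : ℝ} (hδ : 0 < δ) (hr₀ : M < r₀)
    (hU₁ : MemLp (fun r => shiftPow M (t - 1) r * U.1 r) 2 (volume.restrict (Ioc M (M + δ))))
    (hU₂ : MemLp (fun r => shiftPow M t r * U.2 r) 2 (volume.restrict (Ioc M (M + δ))))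
    (hW₁ : MemLp (fun r => shiftPow M (-t - 1) r * (KerrTeukolsky.ladder M (-ω) q (-t) U n).1 r) 2
      (volume.restrict (Ioc M (M + δ))))
    (hW₂ : MemLp (fun r => shiftPow M (-t) r * (KerrTeukolsky.ladder M (-ω) q (-t) U n).2 r) 2
      (volume.restrict (Ioc M (M + δ))))
    (h₁ : MemLp (fun r => shiftPow M (t - 1) r * U.1 r) 2 (volume.restrict (Ioi r₀)))
    (h₂ : MemLp (fun r => shiftPow M t r * outDeriv M ω U r) 2 (volume.restrict (Ioi r₀))) :
    ∀ r, M < r → U.1 r = 0 := by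
  set W := KerrTeukolsky.ladder M (-ω) q (-t) U n with hWdef
  have ht : 0 ≤ t := by have : (0 : ℝ) ≤ n := n.cast_nonneg; linarith
  have hW : IsReducedSolution M ω q (-t) W := by
    apply of_neg
    have := hU.neg.ladder n
    rwa [hn, show -t + 2 * t = - -t by ring] at this
  have hwr := wronskian_eq_zero hU hW hδ hU₁ hU₂ hW₁ hW₂
  obtain ⟨ha, -, hc⟩ := memLp_lower_ladder hr₀ h₁ h₂ n
  rw [show t - (n : ℝ) = -t by linarith] at ha hc
  have hωpos : 0 < |ω| := abs_pos.2 hω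
  set k : ℝ := (2 * |ω|) ^ n with hk
  have hkpos : 0 < k := by positivity
  -- If ‖F‖ > C H, the summand 1 gives H ≤ ‖F‖. Then the flux inequality and Y ≈ (2iω)ⁿ F, with
  -- error at most H, give 2|ω|k ‖F‖ ≤ (2|ω| + 2 + k) H, a contradiction.
  set C : ℝ := 1 + (2 * |ω| + 2 + k) / (2 * |ω| * k) with hC
  have hC1 : 1 ≤ C := by
    have : 0 ≤ (2 * |ω| + 2 + k) / (2 * |ω| * k) := by positivity
    linarith
  have hF : MemLp (fun r => shiftPow M t r * U.1 r) 2 (volume.restrict (Ioi r₀)) := by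
    refine memLp_two_of_le measurableSet_Ioi (((contDiffOn_shiftPow M t).mul
      hU.contDiffOn.1).continuousOn.mono (Ioi_subset_Ioi hr₀.le)) C
      ((ha.norm.add hc.norm).add h₂.norm) fun r hr => ?_
    have hr := hr₀.trans hr
    have hx : 0 < r - M := sub_pos.2 hr
    have h0 := ofReal_sub_ne_zero hr
    simp only [Pi.add_apply]
    set F := shiftPow M t r * U.1 r
    set Y := shiftPow M (-t) r * W.1 r
    set e := shiftPow M (-t) r * outDeriv M ω W r
    set f := shiftPow M t r * outDeriv M ω U r
    set H : ℝ := ‖Y - (2 * Complex.I * ω) ^ n * F‖ + ‖e‖ + ‖f‖ with hH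
    have hHn : 0 ≤ H := by positivity
    rw [Real.norm_of_nonneg hHn]
    have hkF : ‖(2 * Complex.I * ω) ^ n * F‖ = k * ‖F‖ := by simp [hk]
    have hY1 : k * ‖F‖ ≤ ‖Y‖ + H := by
      rw [← hkF]
      have := norm_le_norm_add_norm_sub Y ((2 * Complex.I * ω) ^ n * F)
      linarith [norm_nonneg e, norm_nonneg f]
    have hY2 : ‖Y‖ ≤ k * ‖F‖ + H := by
      rw [← hkF]
      have := norm_le_norm_add_norm_sub ((2 * Complex.I * ω) ^ n * F) Y
      rw [norm_sub_rev] at this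
      linarith [norm_nonneg e, norm_nonneg f]
    have hflux : 2 * |ω| * (‖F‖ * ‖Y‖) ≤ ‖F‖ * H + H * ‖Y‖ := by
      have hst : ∀ s, star (shiftPow M s r) = shiftPow M s r := fun s => by simp [shiftPow]
      -- Replacing U' and W' by outgoing derivatives in the vanishing current leaves exactly this
      -- multiple of F times the conjugate of Y.
      have h1 : 2 * Complex.I * ω * ((r + M) / (r - M)) * (F * star Y)
          = F * star e - f * star Y := by
        have hw := hwr r hr
        simp only [F, Y, e, f, outDeriv, star_mul', star_sub, star_add, hst, star_div₀,
          Complex.star_def, Complex.conj_ofReal, Complex.conj_I] at hw ⊢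
        linear_combination (-(shiftPow M t r * shiftPow M (-t) r)) * hw
      have h2 : ‖(r + M : ℂ) / (r - M)‖ = (r + M) / (r - M) := by
        rw [← Complex.ofReal_add, ← Complex.ofReal_sub, ← Complex.ofReal_div, Complex.norm_real,
          Real.norm_of_nonneg (div_nonneg (by linarith) hx.le)]
      have h3 := congrArg norm h1
      rw [norm_mul, norm_mul, norm_mul F, norm_star, h2] at h3
      simp only [norm_mul, Complex.norm_ofNat, Complex.norm_I, mul_one, Complex.norm_real,
        Real.norm_eq_abs] at h3
      have h4 : 1 ≤ (r + M) / (r - M) := by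
        rw [one_le_div hx]; linarith
      have h5 : ‖F * star e - f * star Y‖ ≤ ‖F‖ * ‖e‖ + ‖f‖ * ‖Y‖ :=
        (norm_sub_le _ _).trans (by simp)
      have h6 : ‖e‖ ≤ H := by
        linarith [norm_nonneg f, norm_nonneg (Y - (2 * Complex.I * ω) ^ n * F)]
      have h7 : ‖f‖ ≤ H := by
        linarith [norm_nonneg e, norm_nonneg (Y - (2 * Complex.I * ω) ^ n * F)]
      calc 2 * |ω| * (‖F‖ * ‖Y‖) = 2 * |ω| * 1 * (‖F‖ * ‖Y‖) := by ring
        _ ≤ 2 * |ω| * ((r + M) / (r - M)) * (‖F‖ * ‖Y‖) := by gcongr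
        _ ≤ ‖F‖ * ‖e‖ + ‖f‖ * ‖Y‖ := h3.trans_le h5
        _ ≤ _ := by gcongr
    by_contra! hcon
    have hy : 0 < ‖F‖ := lt_of_le_of_lt (by positivity) hcon
    have hHF : H ≤ ‖F‖ := by nlinarith
    have h1 : 2 * |ω| * k * (‖F‖ * ‖F‖) ≤ (2 * |ω| + 2 + k) * (‖F‖ * H) := by
      have a1 := mul_le_mul_of_nonneg_left hY1 (by positivity : 0 ≤ 2 * |ω| * ‖F‖)
      have a2 := mul_le_mul_of_nonneg_left hY2 hHn
      have a3 := mul_le_mul_of_nonneg_left hHF hHn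
      nlinarith
    have h2 : 2 * |ω| * k * ‖F‖ ≤ (2 * |ω| + 2 + k) * H := by
      refine le_of_mul_le_mul_left ?_ hy
      linarith
    have h3 : ‖F‖ ≤ (2 * |ω| + 2 + k) / (2 * |ω| * k) * H := by
      rw [div_mul_eq_mul_div, le_div_iff₀ (by positivity)]
      linarith
    have h4 : C * H = H + (2 * |ω| + 2 + k) / (2 * |ω| * k) * H := by rw [hC]; ring
    linarith
  have hF' : MemLp (fun r => shiftPow M t r * U.2 r) 2 (volume.restrict (Ioi r₀)) := by
    refine memLp_two_congr measurableSet_Ioi (fun r hr => ?_) ((h₂.add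
      (hF.const_mul (Complex.I * ω))).add (h₁.const_mul (2 * Complex.I * ω * M)))
    have hr := hr₀.trans hr
    have h0 := ofReal_sub_ne_zero hr
    simp only [Pi.add_apply, outDeriv]
    rw [shiftPow_sub_one t hr]
    field_simp
    ring
  exact eq_zero_of_memLp_Ioi hM hω ht hU hr₀ hF hF'

end IsReducedSolution

/-! ### Ladder operators and regularity at the horizon -/

section Horizon

variable {M ω q σ t δ : ℝ} {v : (ℝ → ℂ) × (ℝ → ℂ)}

lemma memLp_two_mul_of_continuous {h f : ℝ → ℂ} (hh : Continuous h)
    (hf : MemLp f 2 (volume.restrict (Ioc M (M + δ)))) :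
    MemLp (fun r => h r * f r) 2 (volume.restrict (Ioc M (M + δ))) := by
  obtain ⟨C, hC⟩ := (isCompact_Icc (a := M) (b := M + δ)).exists_bound_of_continuousOn
    hh.continuousOn
  exact memLp_two_mul_of_bdd measurableSet_Ioc hh.continuousOn C
    (fun r hr => hC r (Ioc_subset_Icc_self hr)) hf

/-- The pair of weights x^(-t-1), x^(-t) is adapted to x d/dr and need not follow the spin: raising
is x d/dr plus a bounded coefficient, and the singular term q/x in the derivative acts on u, whose
weight has the extra x⁻¹. -/
lemma memLp_raise
    (h₁ : MemLp (fun r => shiftPow M (-t - 1) r * v.1 r) 2 (volume.restrict (Ioc M (M + δ))))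
    (h₂ : MemLp (fun r => shiftPow M (-t) r * v.2 r) 2 (volume.restrict (Ioc M (M + δ)))) :
    MemLp (fun r => shiftPow M (-t - 1) r * (raise M ω q σ v).1 r) 2
      (volume.restrict (Ioc M (M + δ))) ∧
    MemLp (fun r => shiftPow M (-t) r * (raise M ω q σ v).2 r) 2
      (volume.restrict (Ioc M (M + δ))) := by
  constructor
  · have hb : Continuous fun r : ℝ => (σ - Complex.I * ω * (r + M) : ℂ) := by fun_prop
    refine memLp_two_congr measurableSet_Ioc (fun r hr => ?_)
      (h₂.add (memLp_two_mul_of_continuous hb h₁))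
    simp only [Pi.add_apply, raise]
    rw [shiftPow_sub_one (-t) hr.1]
    ring
  · have hb : Continuous fun r : ℝ => (σ + 1 - Complex.I * ω * (r + M) : ℂ) := by fun_prop
    have hc : Continuous fun r : ℝ => ((r - M) ^ 2 * ω ^ 2 + (4 * M * ω ^ 2
      + 2 * Complex.I * ω * σ + Complex.I * ω) * (r - M) + q : ℂ) := by fun_prop
    refine memLp_two_congr measurableSet_Ioc (fun r hr => ?_)
      ((memLp_two_mul_of_continuous hb h₂).sub (memLp_two_mul_of_continuous hc h₁))
    have h0 := IsReducedSolution.ofReal_sub_ne_zero hr.1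
    simp only [Pi.sub_apply, raise]
    rw [shiftPow_sub_one (-t) hr.1]
    field_simp
    ring

lemma memLp_ladder
    (h₁ : MemLp (fun r => shiftPow M (-t - 1) r * v.1 r) 2 (volume.restrict (Ioc M (M + δ))))
    (h₂ : MemLp (fun r => shiftPow M (-t) r * v.2 r) 2 (volume.restrict (Ioc M (M + δ)))) (n : ℕ) :
    MemLp (fun r => shiftPow M (-t - 1) r * (ladder M ω q σ v n).1 r) 2
      (volume.restrict (Ioc M (M + δ))) ∧
    MemLp (fun r => shiftPow M (-t) r * (ladder M ω q σ v n).2 r) 2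
      (volume.restrict (Ioc M (M + δ))) := by
  induction n with
  | zero => exact ⟨h₁, h₂⟩
  | succ n ih => exact memLp_raise ih.1 ih.2

/-- The raising operator is injective on solutions which are regular at the horizon. -/
lemma eq_zero_of_raise_eq_zero (h : IsReducedSolution M ω q σ v) (hδ : 0 < δ) (hδ1 : δ ≤ 1)
    (hσ : 0 ≤ t + σ)
    (h₁ : MemLp (fun r => shiftPow M (-t - 1) r * v.1 r) 2 (volume.restrict (Ioc M (M + δ))))
    (h0 : ∀ r, M < r → (raise M ω q σ v).1 r = 0) : ∀ r, M < r → v.1 r = 0 := by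
  set y : ℝ → ℂ := fun r => shiftPow M σ r * v.1 r with hy
  -- The kernel of raising consists of multiples of x^(-σ) times a phase, so |x^σ u| is constant.
  have hd : ∀ r, M < r → HasDerivAt (fun r => ‖y r‖ ^ 2) 0 r := fun r hr => by
    have hx := IsReducedSolution.ofReal_sub_ne_zero hr
    have hyd : HasDerivAt y (((ω * (r + M) / (r - M) : ℝ) : ℂ) * (Complex.I * y r)) r := by
      refine ((hasDerivAt_shiftPow hr).fun_mul (h.1 r hr)).congr_deriv ?_
      have := h0 r hr
      simp only [raise] at this
      simp only [hy]
      rw [shiftPow_sub_one σ hr]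
      push_cast
      field_simp
      linear_combination shiftPow M (σ - 1) r * this
    refine hyd.norm_sq.congr_deriv ?_
    rw [← Complex.real_smul, inner_smul_right, Complex.inner]
    simp only [Complex.mul_re, Complex.mul_im, Complex.conj_re, Complex.conj_im, Complex.I_re,
      Complex.I_im]
    ring
  obtain ⟨c, hc⟩ := isOpen_Ioi.exists_is_const_of_deriv_eq_zero isPreconnected_Ioi
    (fun r hr => (hd r hr).differentiableAt.differentiableWithinAt) (fun r hr => (hd r hr).deriv)
  suffices c = 0 by
    intro r hr
    have h2 := hc r hr
    rw [this] at h2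
    simpa [hy, shiftPow_ne_zero σ hr] using h2
  by_contra hne
  have hcpos : 0 < c := lt_of_le_of_ne
    (by rw [← hc (M + 1) (by simp)]; positivity) (Ne.symm hne)
  have hint : IntegrableOn (fun r => (r - M)⁻¹) (Ioc M (M + δ)) := by
    refine Integrable.mono' ((h₁.integrable_norm_pow two_ne_zero).const_mul c⁻¹)
      (by fun_prop) ((ae_restrict_iff' measurableSet_Ioc).2 (.of_forall fun r hr => ?_))
    have hx : 0 < r - M := sub_pos.2 hr.1
    have e1 : shiftPow M (-t - 1) r * v.1 r = shiftPow M (-t - 1 - σ) r * y r := by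
      simp only [hy]
      rw [← mul_assoc, ← shiftPow_add _ _ hr.1, sub_add_cancel]
    rw [e1, norm_mul, mul_pow, norm_shiftPow _ hr.1, hc r hr.1, mul_comm _ c,
      inv_mul_cancel_left₀ hne, ← Real.rpow_two, ← Real.rpow_mul hx.le,
      Real.norm_of_nonneg (by positivity), ← Real.rpow_neg_one]
    -- Here x ≤ δ ≤ 1, and the exponent is at most -2 because t + σ ≥ 0.
    exact Real.rpow_le_rpow_of_exponent_ge hx (by linarith [hr.2]) (by linarith)
  have h3 : IntervalIntegrable (fun r => (r - M)⁻¹) volume M (M + δ) :=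
    (intervalIntegrable_iff_integrableOn_Ioc_of_le (by linarith)).2 hint
  rw [intervalIntegrable_sub_inv_iff] at h3
  rcases h3 with h3 | h3
  · linarith
  · exact h3 left_mem_uIcc

lemma eq_zero_of_ladder_eq_zero (h : IsReducedSolution M ω q σ v) (hδ : 0 < δ) (hδ1 : δ ≤ 1)
    (hσ : 0 ≤ t + σ)
    (h₁ : MemLp (fun r => shiftPow M (-t - 1) r * v.1 r) 2 (volume.restrict (Ioc M (M + δ))))
    (h₂ : MemLp (fun r => shiftPow M (-t) r * v.2 r) 2 (volume.restrict (Ioc M (M + δ)))) {n : ℕ}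
    (h0 : ∀ r, M < r → (ladder M ω q σ v n).1 r = 0) : ∀ r, M < r → v.1 r = 0 := by
  induction n with
  | zero => exact h0
  | succ n ih =>
    exact ih (eq_zero_of_raise_eq_zero (h.ladder n) hδ hδ1
      (by have : (0 : ℝ) ≤ n := n.cast_nonneg; linarith) (memLp_ladder h₁ h₂ n).1 h0)

end Horizon

/-! ### Reduction of the radial Teukolsky equation -/

section Reduction

variable {M a s m ω lam : ℝ} {R : ℝ → ℂ}

lemma Delta_eq (ha : a ^ 2 = M ^ 2) (r : ℝ) : Delta M a r = (r - M) ^ 2 := by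
  rw [Delta, ha]; ring

lemma K_eq (ha : a ^ 2 = M ^ 2) (hm : a * m = 2 * M ^ 2 * ω) (r : ℝ) :
    K a ω m r = ω * (r + M) * (r - M) := by
  rw [K, ha, hm]; ring

lemma K_div_Delta (ha : a ^ 2 = M ^ 2) (hm : a * m = 2 * M ^ 2 * ω) {r : ℝ} (hr : M < r) :
    K a ω m r / Delta M a r = ω * (r + M) / (r - M) := by
  have : r - M ≠ 0 := (sub_pos.2 hr).ne'
  rw [K_eq ha hm, Delta_eq ha]
  field_simp

lemma Delta_rpow (ha : a ^ 2 = M ^ 2) (t : ℝ) {r : ℝ} (hr : M < r) :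
    ((Delta M a r ^ t : ℝ) : ℂ) = shiftPow M (2 * t) r := by
  rw [Delta_eq ha, shiftPow, ← Real.rpow_two, ← Real.rpow_mul (sub_pos.2 hr).le]

lemma rPlus_eq (ha : a ^ 2 = M ^ 2) : rPlus M a = M := by
  simp [rPlus, ha]

/-- The rescaled radial function `(r - M)^(s+1) R` and its derivative. -/
def reducedPair (M s : ℝ) (R : ℝ → ℂ) : (ℝ → ℂ) × (ℝ → ℂ) :=
  (fun r => shiftPow M (s + 1) r * R r,
    fun r => (s + 1) * shiftPow M s r * R r + shiftPow M (s + 1) r * deriv R r)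

/-- K has the factor r - M, so (K² - 2is(r - M)K)/Δ is a polynomial in r. The power s + 1 removes
the first-order term of the equation. -/
lemma isReducedSolution_reducedPair (ha : a ^ 2 = M ^ 2)
    (hm : a * m = 2 * M ^ 2 * ω) (hR : IsRadialSolution M a s ω m lam R) :
    IsReducedSolution M ω (7 * M ^ 2 * ω ^ 2 - lam - s * (s + 1)) s (reducedPair M s R) := by
  obtain ⟨hc, he⟩ := hR
  rw [rPlus_eq ha] at hc he
  have hR1 : ∀ r, M < r → HasDerivAt R (deriv R r) r := fun r hr =>
    ((hc.differentiableOn (by norm_num)).differentiableAt (Ioi_mem_nhds hr)).hasDerivAt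
  have hc' : ContDiffOn ℝ 1 (deriv R) (Ioi M) :=
    ((contDiffOn_succ_iff_deriv_of_isOpen (n := 1) isOpen_Ioi).1 (hc.of_le (by norm_num))).2.2
  have hR2 : ∀ r, M < r → HasDerivAt (deriv R) (deriv (deriv R) r) r := fun r hr =>
    ((hc'.differentiableOn (by norm_num)).differentiableAt (Ioi_mem_nhds hr)).hasDerivAt
  refine ⟨fun r hr => ?_, fun r hr => ?_⟩
  · refine ((hasDerivAt_shiftPow hr).fun_mul (hR1 r hr)).congr_deriv ?_
    simp [reducedPair]
  · have hx := IsReducedSolution.ofReal_sub_ne_zero hr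
    have h1 : deriv (fun y => ((Delta M a y ^ (s + 1) : ℝ) : ℂ) * deriv R y) r =
        (2 * (s + 1) : ℝ) * shiftPow M (2 * (s + 1) - 1) r * deriv R r
          + shiftPow M (2 * (s + 1)) r * deriv (deriv R) r := by
      rw [← ((hasDerivAt_shiftPow hr).fun_mul (hR2 r hr)).deriv]
      refine Filter.EventuallyEq.deriv_eq ?_
      filter_upwards [Ioi_mem_nhds hr] with y hy
      rw [Delta_rpow ha _ hy]
    have h2 := he r hr
    rw [radialOp, h1, Delta_rpow ha _ hr, K_eq ha hm, Delta_eq ha] at h2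
    have e1 : shiftPow M (2 * -s) r * shiftPow M (2 * (s + 1) - 1) r = (r - M) := by
      rw [← shiftPow_add _ _ hr, show 2 * -s + (2 * (s + 1) - 1) = 1 by ring, shiftPow_one]
    have e2 : shiftPow M (2 * -s) r * shiftPow M (2 * (s + 1)) r = (r - M) ^ 2 := by
      rw [← shiftPow_add _ _ hr, show 2 * -s + 2 * (s + 1) = 1 + 1 by ring,
        shiftPow_add_one _ hr, shiftPow_one, sq]
    have hm' : (a * m : ℂ) = 2 * M ^ 2 * ω := by exact_mod_cast hm
    have ha' : (a ^ 2 : ℂ) = M ^ 2 := by exact_mod_cast ha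
    have h3 : (r - M) ^ 2 * deriv (deriv R) r + 2 * (s + 1) * (r - M) * deriv R r
        + (ω ^ 2 * (r + M) ^ 2 - 2 * Complex.I * s * ω * (r + M) + 4 * Complex.I * s * ω * r
          - lam + 3 * M ^ 2 * ω ^ 2) * R r = 0 := by
      have h4 : (((ω * (r + M) * (r - M) : ℝ) : ℂ) ^ 2
          - 2 * Complex.I * s * (r - M) * ((ω * (r + M) * (r - M) : ℝ) : ℂ))
            / (((r - M) ^ 2 : ℝ) : ℂ)
          = ω ^ 2 * (r + M) ^ 2 - 2 * Complex.I * s * ω * (r + M) := by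
        push_cast
        field_simp
      rw [h4] at h2
      push_cast at h2
      linear_combination h2 - 2 * (s + 1) * deriv R r * e1 - deriv (deriv R) r * e2
        + R r * ω ^ 2 * ha' - 2 * R r * ω * hm'
    refine ((((hasDerivAt_shiftPow hr).const_mul ((s + 1 : ℂ))).fun_mul (hR1 r hr)).fun_add
      ((hasDerivAt_shiftPow hr).fun_mul (hR2 r hr))).congr_deriv ?_
    simp only [reducedPair, add_sub_cancel_right]
    rw [shiftPow_add_one s hr, shiftPow_sub_one s hr]
    push_cast
    field_simp
    linear_combination shiftPow M (s - 1) r * h3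

lemma regularField_eq (ha : a ^ 2 = M ^ 2) {r : ℝ} (hr : M < r) :
    regularField M a s R r = (Real.sqrt (r ^ 2 + a ^ 2) : ℂ) *
      (shiftPow M (s - 1) r * (reducedPair M s R).1 r) := by
  simp only [regularField, reducedPair, Complex.ofReal_mul]
  rw [Delta_rpow ha s hr, ← mul_assoc (shiftPow M (s - 1) r), ← shiftPow_add _ _ hr]
  ring_nf

end Reduction

/-! ### What the energy density controls -/

section Energy

variable {M a ω m : ℝ} {h : ℝ → ℝ} {χ : ℝ → ℂ} {r : ℝ}

lemma abs_slope_le_one (hM : 0 < M) (ha : a ^ 2 = M ^ 2) (hh : IsHyperboloidal M a h)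
    (hr : M < r) : |slope M a h r| ≤ 1 := by
  -- On the axis θ = 0 the spacelike condition is |H| < 1.
  have h1 := hh.spacelike r (by rwa [rPlus_eq ha]) 0
  have hN : 0 < r ^ 2 + a ^ 2 := by nlinarith
  rw [← sq_le_one_iff_abs_le_one, slope, mul_pow, div_pow, div_mul_eq_mul_div,
    div_le_one (by positivity)]
  simpa using h1.le

/-- The weights 1 + H and 1 - H are nonnegative with sum 2, and the sign of H decides which of them
is at least 1. -/
lemma energyDensity_bounds (hM : 0 < M) (ha : a ^ 2 = M ^ 2) (hh : IsHyperboloidal M a h)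
    (hr : M < r) :
    ‖χ r‖ ^ 2 ≤ (r ^ 2 + a ^ 2) * energyDensity M a ω m h χ r ∧
    (slope M a h r ≤ 0 → Delta M a r * ‖DPlus M a ω m χ r‖ ^ 2 ≤
      (r ^ 2 + a ^ 2) * energyDensity M a ω m h χ r) ∧
    (0 ≤ slope M a h r → Delta M a r * ‖DMinus M a ω m χ r‖ ^ 2 ≤
      (r ^ 2 + a ^ 2) * energyDensity M a ω m h χ r) := by
  have hN : 0 < r ^ 2 + a ^ 2 := by nlinarith
  have hD : 0 < Delta M a r := by rw [Delta_eq ha]; exact pow_pos (sub_pos.2 hr) 2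
  obtain ⟨hH1, hH2⟩ := abs_le.1 (abs_slope_le_one hM ha hh hr)
  have key : (r ^ 2 + a ^ 2) * energyDensity M a ω m h χ r =
      (1 + slope M a h r) * (Delta M a r * ‖DMinus M a ω m χ r‖ ^ 2)
      + (1 - slope M a h r) * (Delta M a r * ‖DPlus M a ω m χ r‖ ^ 2) + ‖χ r‖ ^ 2 := by
    rw [energyDensity, norm_mul, norm_mul, mul_pow, mul_pow, Complex.norm_real,
      Real.norm_of_nonneg (by positivity)]
    field_simp
  have hA : 0 ≤ Delta M a r * ‖DMinus M a ω m χ r‖ ^ 2 := by positivity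
  have hB : 0 ≤ Delta M a r * ‖DPlus M a ω m χ r‖ ^ 2 := by positivity
  have hC : 0 ≤ ‖χ r‖ ^ 2 := by positivity
  rw [key]
  refine ⟨?_, fun h0 => ?_, fun h0 => ?_⟩ <;> nlinarith

lemma memLp_two_of_lintegral_lt_top {S S' : Set ℝ} {f : ℝ → ℂ} {e : ℝ → ℝ} {C : ℝ}
    (hC : 0 ≤ C) (hS : MeasurableSet S) (hSS' : S ⊆ S') (hf : ContinuousOn f S)
    (h : ∀ r ∈ S, ‖f r‖ ^ 2 ≤ C * e r) (he : ∫⁻ r in S', ENNReal.ofReal (e r) < ⊤) :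
    MemLp f 2 (volume.restrict S) := by
  have hf' := hf.aestronglyMeasurable (μ := volume) hS
  refine (memLp_two_iff_integrable_sq_norm hf').2 ⟨hf'.norm.pow 2, ?_⟩
  rw [hasFiniteIntegral_iff_ofReal (.of_forall fun r => by positivity)]
  calc ∫⁻ r in S, ENNReal.ofReal (‖f r‖ ^ 2)
      ≤ ∫⁻ r in S, ENNReal.ofReal C * ENNReal.ofReal (e r) := by
        refine setLIntegral_mono' hS fun r hr => ?_
        rw [← ENNReal.ofReal_mul hC]
        exact ENNReal.ofReal_le_ofReal (h r hr)
    _ = ENNReal.ofReal C * ∫⁻ r in S, ENNReal.ofReal (e r) :=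
        lintegral_const_mul' _ _ ENNReal.ofReal_ne_top
    _ ≤ ENNReal.ofReal C * ∫⁻ r in S', ENNReal.ofReal (e r) := by
        gcongr
    _ < ⊤ := ENNReal.mul_lt_top ENNReal.ofReal_lt_top he

end Energy

/-! ### Bounded multipliers at the two ends -/

section Multipliers

variable {M a : ℝ} {S : Set ℝ}

lemma isBoundedMultiplier_of_contDiff {A B : ℝ} (hS : S ⊆ Icc A B) {h : ℝ → ℂ}
    (hh : ContDiff ℝ (⊤ : ℕ∞) h) : IsBoundedMultiplier M 1 S h := by
  refine ⟨hh.contDiffOn, fun n => ?_⟩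
  have hc : ContDiff ℝ (⊤ : ℕ∞) ((twistedDeriv 1 0)^[n] h) := by
    induction n with
    | zero => exact hh
    | succ n ih =>
      rw [Function.iterate_succ_apply', show twistedDeriv 1 0 = deriv from
        funext fun f => funext fun r => by simp [twistedDeriv]] at *
      exact (contDiff_infty_iff_deriv.1 ih).2
  obtain ⟨C, hC⟩ := (isCompact_Icc (a := A) (b := B)).exists_bound_of_continuousOn
    hc.continuous.continuousOn
  exact ⟨C, fun r hr => hC r (hS hr)⟩

/-- `√(r² + a²)`. -/
def areaRadius (a r : ℝ) : ℝ := Real.sqrt (r ^ 2 + a ^ 2)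

lemma areaRadius_pos (ha : a ≠ 0) (r : ℝ) : 0 < areaRadius a r :=
  Real.sqrt_pos.2 (by positivity)

lemma areaRadius_sq (a r : ℝ) : areaRadius a r ^ 2 = r ^ 2 + a ^ 2 :=
  Real.sq_sqrt (by positivity)

lemma contDiff_areaRadius (ha : a ≠ 0) : ContDiff ℝ (⊤ : ℕ∞) (areaRadius a) := by
  unfold areaRadius
  exact ((contDiff_id.pow 2).add contDiff_const).sqrt fun r => by
    have : 0 < r ^ 2 + a ^ 2 := by positivity
    exact this.ne'

lemma contDiff_areaRadius_inv (ha : a ≠ 0) :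
    ContDiff ℝ (⊤ : ℕ∞) (fun r => (((areaRadius a r)⁻¹ : ℝ) : ℂ)) :=
  Complex.ofRealCLM.contDiff.comp
    ((contDiff_areaRadius ha).inv fun r => (areaRadius_pos ha r).ne')

lemma hasDerivAt_areaRadius_inv (ha : a ≠ 0) (r : ℝ) :
    HasDerivAt (fun r => (areaRadius a r)⁻¹) (-(r / areaRadius a r ^ 3)) r := by
  have hN := (areaRadius_pos ha r).ne'
  have h0 : r ^ 2 + a ^ 2 ≠ 0 := by positivity
  have h1 : HasDerivAt (areaRadius a) (r / areaRadius a r) r := by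
    refine (((hasDerivAt_pow 2 r).add_const (a ^ 2)).sqrt h0).congr_deriv ?_
    simp only [areaRadius]
    field_simp
    norm_num
  refine (h1.fun_inv hN).congr_deriv ?_
  field_simp

/-- Combinations of `r / √(r² + a²)` and `1 / √(r² + a²)` have bounded derivatives along
`(r² + a²) d/dr`. -/
lemma isBoundedMultiplier_areaRadius (ha : a ≠ 0) (α β : ℂ) :
    IsBoundedMultiplier M (fun r => ((r ^ 2 + a ^ 2 : ℝ) : ℂ)) S
      (fun r => (α * r + β) * (((areaRadius a r)⁻¹ : ℝ) : ℂ)) := by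
  refine ⟨(((contDiff_const.mul Complex.ofRealCLM.contDiff).add contDiff_const).mul
    (contDiff_areaRadius_inv ha)).contDiffOn, fun n => ?_⟩
  -- The operator (r² + a²) d/dr maps this two-parameter family to itself, so the induction is over
  -- all α and β at once.
  suffices ∀ α β : ℂ, ∃ C, ∀ r, ‖((twistedDeriv (fun r => ((r ^ 2 + a ^ 2 : ℝ) : ℂ)) 0)^[n]
      (fun r => (α * r + β) * (((areaRadius a r)⁻¹ : ℝ) : ℂ))) r‖ ≤ C by
    obtain ⟨C, hC⟩ := this α β
    exact ⟨C, fun r _ => hC r⟩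
  induction n with
  | zero =>
    intro α β
    refine ⟨‖α‖ + ‖β‖ * |a|⁻¹, fun r => ?_⟩
    have hN := areaRadius_pos ha r
    have h1 : |r| ≤ areaRadius a r := Real.abs_le_sqrt (by nlinarith)
    have h2 : |a| ≤ areaRadius a r := Real.abs_le_sqrt (by nlinarith)
    have h3 : 0 < |a| := abs_pos.2 ha
    rw [Function.iterate_zero, id, norm_mul, Complex.norm_real,
      Real.norm_of_nonneg (inv_nonneg.2 hN.le)]
    calc ‖α * r + β‖ * (areaRadius a r)⁻¹
        ≤ (‖α‖ * |r| + ‖β‖) * (areaRadius a r)⁻¹ := by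
          gcongr
          exact (norm_add_le _ _).trans (by simp)
      _ = ‖α‖ * (|r| * (areaRadius a r)⁻¹) + ‖β‖ * (areaRadius a r)⁻¹ := by ring
      _ ≤ ‖α‖ * 1 + ‖β‖ * |a|⁻¹ := by
          gcongr
          rw [← div_eq_mul_inv]
          exact (div_le_one hN).2 h1
      _ = _ := by ring
  | succ n ih =>
    intro α β
    obtain ⟨C, hC⟩ := ih (-β) (α * a ^ 2)
    suffices twistedDeriv (fun r => ((r ^ 2 + a ^ 2 : ℝ) : ℂ)) 0
        (fun r => (α * r + β) * (((areaRadius a r)⁻¹ : ℝ) : ℂ)) =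
        fun r => (-β * r + α * a ^ 2) * (((areaRadius a r)⁻¹ : ℝ) : ℂ) from
      ⟨C, fun r => by rw [Function.iterate_succ_apply, this]; exact hC r⟩
    funext r
    have hN := (areaRadius_pos ha r).ne'
    have hN' : (areaRadius a r : ℂ) ≠ 0 := by exact_mod_cast hN
    have hsq : (areaRadius a r : ℂ) ^ 2 = r ^ 2 + a ^ 2 := by exact_mod_cast areaRadius_sq a r
    have hd := (((((hasDerivAt_id' r).ofReal_comp).const_mul α).add_const β).fun_mul
      (hasDerivAt_areaRadius_inv ha r).ofReal_comp).deriv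
    simp only [twistedDeriv, hd, Pi.zero_apply, zero_mul, add_zero]
    push_cast
    rw [← hsq]
    field_simp
    linear_combination α * hsq

end Multipliers

/-! ### Finite energy in terms of the reduced solution -/

section Ends

variable {M a s m ω lam : ℝ} {h : ℝ → ℝ} {R : ℝ → ℂ}

lemma contDiffOn_K_div_Delta (ha : a ^ 2 = M ^ 2) (hm : a * m = 2 * M ^ 2 * ω) :
    ContDiffOn ℝ (⊤ : ℕ∞) (fun r => ((K a ω m r / Delta M a r : ℝ) : ℂ)) (Ioi M) := by
  refine Complex.ofRealCLM.contDiff.comp_contDiffOn (ContDiffOn.congr (f := fun r =>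
    ω * (r + M) / (r - M)) ?_ fun r hr => K_div_Delta ha hm hr)
  exact (contDiff_const.mul (contDiff_id.add contDiff_const)).contDiffOn.div
    (contDiff_id.sub contDiff_const).contDiffOn fun r hr => (sub_pos.2 hr).ne'

lemma DPlus_eq_twistedDeriv (M a ω m : ℝ) : (fun (f : ℝ → ℂ) (y : ℝ) => DPlus M a ω m f y) =
    twistedDeriv 1 (fun r => Complex.I * ((K a ω m r / Delta M a r : ℝ) : ℂ)) := by
  funext f y
  simp [DPlus, twistedDeriv]

lemma weighted_DMinus_eq_twistedDeriv (M a ω m : ℝ) :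
    (fun (f : ℝ → ℂ) (y : ℝ) => ((y ^ 2 + a ^ 2 : ℝ) : ℂ) * DMinus M a ω m f y) =
    twistedDeriv (fun r => ((r ^ 2 + a ^ 2 : ℝ) : ℂ))
      (fun r => -(Complex.I * ((K a ω m r / Delta M a r : ℝ) : ℂ))) := by
  funext f y
  simp only [DMinus, twistedDeriv]
  ring

lemma contDiffOn_regularField (ha0 : a ≠ 0) (ha : a ^ 2 = M ^ 2) (hm : a * m = 2 * M ^ 2 * ω)
    (hR : IsRadialSolution M a s ω m lam R) :
    ContDiffOn ℝ (⊤ : ℕ∞) (regularField M a s R) (Ioi M) :=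
  ContDiffOn.congr (((Complex.ofRealCLM.contDiff.comp (contDiff_areaRadius ha0)).contDiffOn).mul
    ((contDiffOn_shiftPow M (s - 1)).mul (isReducedSolution_reducedPair ha hm hR).contDiffOn.1))
    fun _ hr => regularField_eq ha hr

/-- Since 1 + H = O(Δ), H is nonpositive close to the horizon, and there the energy controls √Δ 𝒟⁺χ,
with √Δ = x. -/
lemma exists_squareIntegrableUpTo_horizon (hM : 0 < M) (ha : a ^ 2 = M ^ 2)
    (hm : a * m = 2 * M ^ 2 * ω) (hh : IsHyperboloidal M a h)
    (hR : IsRadialSolution M a s ω m lam R) (hE : hyperboloidalEnergy M a s ω m h R < ⊤) :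
    ∃ δ, 0 < δ ∧ δ ≤ 1 ∧ SquareIntegrableUpTo
      (twistedDeriv 1 (fun r => Complex.I * ((K a ω m r / Delta M a r : ℝ) : ℂ))) 1
      (fun r => (r - M : ℂ)) (Ioc M (M + δ)) ⌊|s| + s⌋₊ (regularField M a s R) := by
  have ha0 : a ≠ 0 := fun h0 => by rw [h0] at ha; nlinarith
  obtain ⟨C, hC⟩ := hh.meets_horizon
  rw [rPlus_eq ha] at hC
  -- The three bounds serve x ≤ 1, M + δ ≤ 3M and C x² ≤ 1.
  set δ : ℝ := min (min 1 (2 * M)) (|C| + 1)⁻¹ with hδ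
  have hδ0 : 0 < δ := by positivity
  have hδ1 : δ ≤ 1 := (min_le_left _ _).trans (min_le_left _ _)
  have hδ2 : δ ≤ 2 * M := (min_le_left _ _).trans (min_le_right _ _)
  have hδ3 : δ ≤ (|C| + 1)⁻¹ := min_le_right _ _
  have hslope : ∀ r ∈ Ioc M (M + δ), slope M a h r ≤ 0 := fun r hr => by
    have hx : 0 < r - M := sub_pos.2 hr.1
    have h1 := hC r hr.1
    rw [Delta_eq ha] at h1
    have h2 : (r - M) * (|C| + 1) ≤ 1 := by
      rw [← le_div_iff₀ (by positivity), one_div]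
      linarith [hr.2]
    have h3 : C * (r - M) ^ 2 ≤ 1 := by
      have h4 : C * (r - M) ^ 2 ≤ |C| * (r - M) ^ 2 :=
        mul_le_mul_of_nonneg_right (le_abs_self C) (by positivity)
      nlinarith [abs_nonneg C, hr.2]
    linarith
  have hsub : Ioc M (M + δ) ⊆ Ioc M (3 * M) := Ioc_subset_Ioc_right (by linarith)
  have hSM : Ioc M (M + δ) ⊆ Ioi M := fun r hr => hr.1
  have hψ : ContDiffOn ℝ (⊤ : ℕ∞)
      (fun r => Complex.I * ((K a ω m r / Delta M a r : ℝ) : ℂ)) (Ioi M) :=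
    contDiffOn_const.mul (contDiffOn_K_div_Delta ha hm)
  have hN : ∀ r ∈ Ioc M (M + δ), r ^ 2 + a ^ 2 ≤ 10 * M ^ 2 := fun r hr => by
    nlinarith [(hsub hr).2, hr.1]
  have hfin : ∀ j ≤ ⌊|s| + s⌋₊, ∫⁻ r in Ioc M (3 * M), ENNReal.ofReal (energyDensity M a ω m h
      ((twistedDeriv 1 (fun r => Complex.I * ((K a ω m r / Delta M a r : ℝ) : ℂ)))^[j]
        (regularField M a s R)) r) < ⊤ := fun j hj => by
    have h1 := ENNReal.sum_lt_top.1 (lt_of_le_of_lt le_self_add hE) j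
      (Finset.mem_range.2 (Nat.lt_succ_of_le hj))
    rwa [rPlus_eq ha, DPlus_eq_twistedDeriv] at h1
  have hsm := contDiffOn_iterate_twistedDeriv (g := 1) contDiffOn_const hψ
    (contDiffOn_regularField ha0 ha hm hR)
  have hbd : ∀ (χ : ℝ → ℂ) (r : ℝ), r ∈ Ioc M (M + δ) →
      0 ≤ energyDensity M a ω m h χ r := fun χ r hr => by
    have := (energyDensity_bounds (ω := ω) (m := m) (χ := χ) hM ha hh hr.1).1
    have h2 : 0 < r ^ 2 + a ^ 2 := by positivity
    exact nonneg_of_mul_nonneg_right ((sq_nonneg _).trans this) h2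
  refine ⟨δ, hδ0, hδ1, SquareIntegrableUpTo.of_iterate (fun j hj => ?_) ?_⟩
  · refine memLp_two_of_lintegral_lt_top (C := 10 * M ^ 2) (by positivity) measurableSet_Ioc hsub
      (continuousOn_const.mul ((hsm j).continuousOn.mono hSM)) (fun r hr => ?_) (hfin j hj)
    rw [Pi.one_apply, one_mul]
    exact (energyDensity_bounds hM ha hh hr.1).1.trans
      (mul_le_mul_of_nonneg_right (hN r hr) (hbd _ r hr))
  · have hxc : Continuous fun r : ℝ => (r - M : ℂ) := by fun_prop
    refine memLp_two_of_lintegral_lt_top (C := 10 * M ^ 2) (by positivity) measurableSet_Ioc hsub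
      (hxc.continuousOn.mul ((hsm _).continuousOn.mono hSM)) (fun r hr => ?_)
      (hfin _ le_rfl)
    refine le_trans (le_of_eq ?_)
      (((energyDensity_bounds hM ha hh hr.1).2.1 (hslope r hr)).trans
        (mul_le_mul_of_nonneg_right (hN r hr) (hbd _ r hr)))
    rw [Function.iterate_succ_apply', ← DPlus_eq_twistedDeriv, Delta_eq ha, norm_mul, mul_pow,
      ← Complex.ofReal_sub, Complex.norm_real, Real.norm_eq_abs, sq_abs]

/-- Since 1 - H = O(r⁻²), H is nonnegative far out, and there the energy controls 𝒟⁻χ, because Δ and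
r² + a² are comparable beyond 3M. -/
lemma exists_squareIntegrableUpTo_infinity (hM : 0 < M) (ha : a ^ 2 = M ^ 2)
    (hm : a * m = 2 * M ^ 2 * ω) (hh : IsHyperboloidal M a h)
    (hR : IsRadialSolution M a s ω m lam R) (hE : hyperboloidalEnergy M a s ω m h R < ⊤) :
    ∃ r₀, 3 * M ≤ r₀ ∧ SquareIntegrableUpTo
      (twistedDeriv (fun r => ((r ^ 2 + a ^ 2 : ℝ) : ℂ))
        (fun r => -(Complex.I * ((K a ω m r / Delta M a r : ℝ) : ℂ))))
      (fun r => (((areaRadius a r)⁻¹ : ℝ) : ℂ)) (fun r => (((areaRadius a r)⁻¹ : ℝ) : ℂ) ^ 2)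
      (Ioi r₀) ⌊|s| - s⌋₊ (regularField M a s R) := by
  have ha0 : a ≠ 0 := fun h0 => by rw [h0] at ha; nlinarith
  obtain ⟨C, hC⟩ := hh.meets_scri
  rw [rPlus_eq ha] at hC
  set r₀ : ℝ := 3 * M + |C| + 1 with hr₀
  have hr₀3 : 3 * M ≤ r₀ := by linarith [abs_nonneg C]
  have hSM' : ∀ r ∈ Ioi r₀, M < r := fun r hr => by linarith [mem_Ioi.1 hr]
  have hslope : ∀ r ∈ Ioi r₀, 0 ≤ slope M a h r := fun r hr => by
    have h1 := hC r (hSM' r hr)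
    have hr' : |C| + 1 < r := by linarith [mem_Ioi.1 hr]
    have h2 : C / r ^ 2 ≤ 1 := by
      have := abs_nonneg C
      have : 0 < r := by linarith
      rw [div_le_one (by positivity)]
      nlinarith [le_abs_self C]
    linarith
  have hsub : Ioi r₀ ⊆ Ioi (3 * M) := Ioi_subset_Ioi hr₀3
  have hSM : Ioi r₀ ⊆ Ioi M := hSM'
  have hψ : ContDiffOn ℝ (⊤ : ℕ∞)
      (fun r => -(Complex.I * ((K a ω m r / Delta M a r : ℝ) : ℂ))) (Ioi M) :=
    (contDiffOn_const.mul (contDiffOn_K_div_Delta ha hm)).neg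
  have hg : ContDiffOn ℝ (⊤ : ℕ∞) (fun r => ((r ^ 2 + a ^ 2 : ℝ) : ℂ)) (Ioi M) :=
    (Complex.ofRealCLM.contDiff.comp ((contDiff_id.pow 2).add contDiff_const)).contDiffOn
  have hfin : ∀ j ≤ ⌊|s| - s⌋₊, ∫⁻ r in Ioi (3 * M), ENNReal.ofReal (energyDensity M a ω m h
      ((twistedDeriv (fun r => ((r ^ 2 + a ^ 2 : ℝ) : ℂ))
        (fun r => -(Complex.I * ((K a ω m r / Delta M a r : ℝ) : ℂ))))^[j]
        (regularField M a s R)) r) < ⊤ := fun j hj => by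
    have h1 := ENNReal.sum_lt_top.1 (lt_of_le_of_lt le_add_self hE) j
      (Finset.mem_range.2 (Nat.lt_succ_of_le hj))
    rwa [weighted_DMinus_eq_twistedDeriv] at h1
  have hsm := contDiffOn_iterate_twistedDeriv hg hψ (contDiffOn_regularField ha0 ha hm hR)
  have hwc : Continuous fun r => (((areaRadius a r)⁻¹ : ℝ) : ℂ) :=
    (contDiff_areaRadius_inv ha0).continuous
  have hw : ∀ r, ‖(((areaRadius a r)⁻¹ : ℝ) : ℂ)‖ ^ 2 = (r ^ 2 + a ^ 2)⁻¹ := fun r => by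
    rw [Complex.norm_real, Real.norm_eq_abs, sq_abs, inv_pow, areaRadius_sq]
  refine ⟨r₀, hr₀3, SquareIntegrableUpTo.of_iterate (fun j hj => ?_) ?_⟩
  · refine memLp_two_of_lintegral_lt_top (C := 1) zero_le_one measurableSet_Ioi hsub
      (hwc.continuousOn.mul ((hsm j).continuousOn.mono hSM)) (fun r hr => ?_) (hfin j hj)
    have hN : 0 < r ^ 2 + a ^ 2 := by positivity
    rw [norm_mul, mul_pow, hw, one_mul, inv_mul_le_iff₀ hN]
    exact (energyDensity_bounds hM ha hh (hSM hr)).1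
  · refine memLp_two_of_lintegral_lt_top (C := 4) (by norm_num) measurableSet_Ioi hsub
      ((hwc.pow 2).continuousOn.mul ((hsm _).continuousOn.mono hSM)) (fun r hr => ?_)
      (hfin _ le_rfl)
    have hN : 0 < r ^ 2 + a ^ 2 := by positivity
    have h3 : 3 * M < r := hsub hr
    have hD : r ^ 2 + a ^ 2 ≤ 4 * Delta M a r := by
      rw [Delta_eq ha, ha]
      nlinarith
    set χ := (twistedDeriv (fun r => ((r ^ 2 + a ^ 2 : ℝ) : ℂ))
        (fun r => -(Complex.I * ((K a ω m r / Delta M a r : ℝ) : ℂ))))^[⌊|s| - s⌋₊]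
        (regularField M a s R) with hχ
    have h1 := (energyDensity_bounds (ω := ω) (m := m) (χ := χ) hM ha hh (hSM hr)).2.2
      (hslope r hr)
    rw [Function.iterate_succ_apply', ← hχ, ← weighted_DMinus_eq_twistedDeriv, norm_mul, mul_pow,
      norm_pow, hw, norm_mul, mul_pow, Complex.norm_real, Real.norm_of_nonneg hN.le,
      ← mul_assoc, ← mul_pow, inv_mul_cancel₀ hN.ne', one_pow, one_mul]
    have h2 := mul_le_mul_of_nonneg_right hD (sq_nonneg ‖DMinus M a ω m χ r‖)
    refine le_of_mul_le_mul_left ?_ hN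
    linarith

/-- Finite energy of the radial function near the horizon, in terms of the reduced solution. -/
lemma memLp_of_squareIntegrableUpTo_zero {q σ τ δ : ℝ} {v : (ℝ → ℂ) × (ℝ → ℂ)}
    {ψ : ℝ → ℂ} (hψ : ∀ r, M < r → ψ r = -(Complex.I * ω * (r + M) / (r - M)))
    (hv : IsReducedSolution M ω q σ v)
    (hP : SquareIntegrableUpTo (twistedDeriv 1 ψ) 1 (fun r => (r - M : ℂ)) (Ioc M (M + δ)) 0
      (fun r => shiftPow M τ r * v.1 r)) :
    MemLp (fun r => shiftPow M τ r * v.1 r) 2 (volume.restrict (Ioc M (M + δ))) ∧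
    MemLp (fun r => shiftPow M (τ + 1) r * v.2 r) 2 (volume.restrict (Ioc M (M + δ))) := by
  have h1 : MemLp (fun r => shiftPow M τ r * v.1 r) 2 (volume.restrict (Ioc M (M + δ))) :=
    memLp_two_congr measurableSet_Ioc (fun r _ => by simp) hP.1
  refine ⟨h1, ?_⟩
  have hb : Continuous fun r : ℝ => (τ - Complex.I * ω * (r + M) : ℂ) := by fun_prop
  refine memLp_two_congr measurableSet_Ioc (fun r hr => ?_)
    (hP.2.sub (memLp_two_mul_of_continuous hb h1))
  simp only [Pi.sub_apply]
  rw [hv.twistedDeriv_shiftPow_mul _ hψ _ hr.1, shiftPow_add_one _ hr.1, shiftPow_sub_one τ hr.1,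
    Pi.one_apply]
  ring

lemma squareIntegrableUpTo_horizon_reduced {δ : ℝ} {n : ℕ} (ha0 : a ≠ 0) (ha : a ^ 2 = M ^ 2)
    (hm : a * m = 2 * M ^ 2 * ω) (hδ1 : δ ≤ 1) (hR : IsRadialSolution M a s ω m lam R)
    (hP : SquareIntegrableUpTo
      (twistedDeriv 1 (fun r => Complex.I * ((K a ω m r / Delta M a r : ℝ) : ℂ))) 1
      (fun r => (r - M : ℂ)) (Ioc M (M + δ)) n (regularField M a s R)) :
    SquareIntegrableUpTo
      (twistedDeriv 1 (fun r => Complex.I * ((K a ω m r / Delta M a r : ℝ) : ℂ))) 1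
      (fun r => (r - M : ℂ)) (Ioc M (M + δ)) n
      (fun r => shiftPow M (s - 1) r * (reducedPair M s R).1 r) ∧
    SquareIntegrableUpTo
      (twistedDeriv 1 (fun r => Complex.I * ((K a ω m r / Delta M a r : ℝ) : ℂ))) 1
      (fun r => (r - M : ℂ)) (Ioc M (M + δ)) 0
      (fun r => shiftPow M (s - 1) r * (reducedPair M s R).1 r) := by
  have hψ : ContDiffOn ℝ (⊤ : ℕ∞)
      (fun r => Complex.I * ((K a ω m r / Delta M a r : ℝ) : ℂ)) (Ioi M) :=
    contDiffOn_const.mul (contDiffOn_K_div_Delta ha hm)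
  have hSM : Ioc M (M + δ) ⊆ Ioi M := fun r hr => hr.1
  have hxc : Continuous fun r : ℝ => (r - M : ℂ) := by fun_prop
  have hw : ∀ r ∈ Ioc M (M + δ), ‖(r - M : ℂ)‖ ≤ 1 * ‖(1 : ℝ → ℂ) r‖ := fun r hr => by
    rw [← Complex.ofReal_sub, Complex.norm_real, Real.norm_of_nonneg (sub_pos.2 hr.1).le]
    simpa using by linarith [hr.2]
  have h1 := SquareIntegrableUpTo.mul measurableSet_Ioc hSM (g := 1) contDiffOn_const hψ
    continuousOn_const hxc.continuousOn hw (contDiffOn_regularField ha0 ha hm hR)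
    (isBoundedMultiplier_of_contDiff Ioc_subset_Icc_self (contDiff_areaRadius_inv ha0)) hP
  have h2 := SquareIntegrableUpTo.congr measurableSet_Ioc hSM (χ := fun r =>
      shiftPow M (s - 1) r * (reducedPair M s R).1 r) (fun r hr => by
    have hN : (areaRadius a r : ℂ) ≠ 0 := by exact_mod_cast (areaRadius_pos ha0 r).ne'
    rw [regularField_eq ha hr]
    change _ = _ * ((areaRadius a r : ℂ) * _)
    rw [Complex.ofReal_inv, inv_mul_cancel_left₀ hN]) h1
  exact ⟨h2, SquareIntegrableUpTo.mono_zero measurableSet_Ioc hSM (g := 1) contDiffOn_const hψ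
    hxc.continuousOn hw ((contDiffOn_shiftPow M _).mul
      (isReducedSolution_reducedPair ha hm hR).contDiffOn.1) h2⟩

/-- Finite energy of the radial function near infinity, in terms of the reduced solution. -/
lemma memLp_infinity {r₀ t : ℝ} {n : ℕ} (hM : 0 < M) (ha : a ^ 2 = M ^ 2)
    (hm : a * m = 2 * M ^ 2 * ω) (hr₀ : 3 * M ≤ r₀) (hR : IsRadialSolution M a s ω m lam R)
    (hn : s + n = t) {q : ℝ} (hv : IsReducedSolution M ω q s (reducedPair M s R))
    (hP : SquareIntegrableUpTo
      (twistedDeriv (fun r => ((r ^ 2 + a ^ 2 : ℝ) : ℂ))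
        (fun r => -(Complex.I * ((K a ω m r / Delta M a r : ℝ) : ℂ))))
      (fun r => (((areaRadius a r)⁻¹ : ℝ) : ℂ)) (fun r => (((areaRadius a r)⁻¹ : ℝ) : ℂ) ^ 2)
      (Ioi r₀) n (regularField M a s R)) :
    MemLp (fun r => shiftPow M (t - 1) r * (ladder M ω q s (reducedPair M s R) n).1 r) 2
      (volume.restrict (Ioi r₀)) ∧
    MemLp (fun r => shiftPow M t r *
      IsReducedSolution.outDeriv M ω (ladder M ω q s (reducedPair M s R) n) r) 2
      (volume.restrict (Ioi r₀)) := by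
  have ha0 : a ≠ 0 := fun h0 => by rw [h0] at ha; nlinarith
  have hψ : ContDiffOn ℝ (⊤ : ℕ∞)
      (fun r => -(Complex.I * ((K a ω m r / Delta M a r : ℝ) : ℂ))) (Ioi M) :=
    (contDiffOn_const.mul (contDiffOn_K_div_Delta ha hm)).neg
  have hψ' : ∀ r, M < r → -(Complex.I * ((K a ω m r / Delta M a r : ℝ) : ℂ)) =
      -(Complex.I * ω * (r + M) / (r - M)) := fun r hr => by
    rw [K_div_Delta ha hm hr]; push_cast; ring
  have hg : ContDiffOn ℝ (⊤ : ℕ∞) (fun r => ((r ^ 2 + a ^ 2 : ℝ) : ℂ)) (Ioi M) :=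
    (Complex.ofRealCLM.contDiff.comp ((contDiff_id.pow 2).add contDiff_const)).contDiffOn
  have hSM' : ∀ r ∈ Ioi r₀, M < r := fun r hr => by linarith [mem_Ioi.1 hr]
  have hSM : Ioi r₀ ⊆ Ioi M := hSM'
  have hwc : Continuous fun r => (((areaRadius a r)⁻¹ : ℝ) : ℂ) :=
    (contDiff_areaRadius_inv ha0).continuous
  have hN := fun r => areaRadius_pos ha0 r
  have hN' : ∀ r, (areaRadius a r : ℂ) ≠ 0 := fun r => by exact_mod_cast (hN r).ne'
  have hw : ∀ r ∈ Ioi r₀, ‖(((areaRadius a r)⁻¹ : ℝ) : ℂ) ^ 2‖ ≤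
      |a|⁻¹ * ‖(((areaRadius a r)⁻¹ : ℝ) : ℂ)‖ := fun r _ => by
    rw [norm_pow, sq, Complex.norm_real, Real.norm_of_nonneg (inv_nonneg.2 (hN r).le)]
    refine mul_le_mul_of_nonneg_right (inv_anti₀ (abs_pos.2 ha0) ?_) (inv_nonneg.2 (hN r).le)
    exact Real.abs_le_sqrt (by nlinarith)
  -- The multiplier g₀ = x/√(r² + a²) turns Ψ into x^s u, and its square turns the weight r² + a²
  -- into x², the one for which outgoing derivatives are spin raising.
  set g₀ : ℝ → ℂ := fun r => (1 * r + (-M : ℂ)) * (((areaRadius a r)⁻¹ : ℝ) : ℂ) with hg₀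
  have hg₀m : IsBoundedMultiplier M (fun r => ((r ^ 2 + a ^ 2 : ℝ) : ℂ)) (Ioi r₀) g₀ :=
    isBoundedMultiplier_areaRadius ha0 1 (-M)
  have hmul := fun {n : ℕ} {χ : ℝ → ℂ} (hχ : ContDiffOn ℝ (⊤ : ℕ∞) χ (Ioi M)) =>
    SquareIntegrableUpTo.mul (n := n) measurableSet_Ioi hSM hg hψ hwc.continuousOn
    (hwc.pow 2).continuousOn hw hχ hg₀m
  have hΨ := contDiffOn_regularField ha0 ha hm hR
  have h1 := SquareIntegrableUpTo.iterate_mul (ρ := fun r => g₀ r * g₀ r) hg hψ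
    (hg₀m.smooth.mul hΨ) (hg₀m.smooth.mul hg₀m.smooth) (fun n χ hχ hPχ => by
      simpa only [mul_assoc] using hmul (hg₀m.smooth.mul hχ) (hmul hχ hPχ)) (hmul hΨ hP)
  have e1 : (fun r => g₀ r * g₀ r * ((r ^ 2 + a ^ 2 : ℝ) : ℂ)) = fun r : ℝ => (r - M : ℂ) ^ 2 := by
    funext r
    have := hN' r
    rw [← areaRadius_sq]
    simp only [hg₀]
    push_cast
    field_simp
    ring
  have e2 : EqOn (fun r => g₀ r * regularField M a s R r)
      (fun r => shiftPow M s r * (reducedPair M s R).1 r) (Ioi M) := fun r hr => by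
    have := hN' r
    beta_reduce
    rw [regularField_eq ha hr, shiftPow_sub_one s hr]
    change g₀ r * ((areaRadius a r : ℂ) * _) = _
    simp only [hg₀]
    push_cast
    field_simp
    ring
  rw [e1] at h1
  have e3 := (iterate_twistedDeriv_eqOn (g := fun r : ℝ => (r - M : ℂ) ^ 2) e2 n).trans
    (hv.iterate_twistedDeriv_shiftPow hψ' n)
  rw [hn] at e3
  have h2 := SquareIntegrableUpTo.congr measurableSet_Ioi hSM e3.symm h1
  have hU := hv.ladder n
  have h3 : MemLp (fun r => shiftPow M (t - 1) r *
      (ladder M ω q s (reducedPair M s R) n).1 r) 2 (volume.restrict (Ioi r₀)) := by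
    refine memLp_two_of_le measurableSet_Ioi (((contDiffOn_shiftPow M (t - 1)).mul
      hU.contDiffOn.1).continuousOn.mono hSM) 2 h2.1 fun r hr => ?_
    have hx : 0 < r - M := sub_pos.2 (hSM hr)
    have hNx : areaRadius a r ≤ 2 * (r - M) := by
      refine Real.sqrt_le_iff.2 ⟨by linarith, ?_⟩
      rw [ha]
      nlinarith [mem_Ioi.1 hr]
    rw [norm_mul, norm_mul, norm_mul, Complex.norm_real, norm_shiftPow _ (hSM hr),
      norm_shiftPow _ (hSM hr), Real.norm_of_nonneg (inv_nonneg.2 (hN r).le),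
      Real.rpow_sub_one hx.ne', ← mul_assoc, ← mul_assoc]
    refine mul_le_mul_of_nonneg_right ?_ (norm_nonneg _)
    rw [div_eq_inv_mul]
    refine mul_le_mul_of_nonneg_right ?_ (Real.rpow_nonneg hx.le t)
    rw [← div_eq_mul_inv, inv_eq_one_div, div_le_div_iff₀ hx (hN r)]
    linarith
  refine ⟨h3, memLp_two_congr measurableSet_Ioi (fun r hr => ?_)
    (h2.2.sub (h3.const_mul (t : ℂ)))⟩
  have hx := IsReducedSolution.ofReal_sub_ne_zero (hSM hr)
  simp only [Pi.sub_apply, Pi.pow_apply]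
  rw [hU.twistedDeriv_shiftPow_mul _ hψ' _ (hSM hr), ← areaRadius_sq]
  simp only [IsReducedSolution.outDeriv]
  rw [shiftPow_sub_one t (hSM hr)]
  have := hN' r
  push_cast
  field_simp
  ring

end Ends

end

end KerrTeukolsky

/-! ### Conclusion: the cases s ≥ 0 and s < 0 -/

open KerrTeukolsky KerrTeukolsky.IsReducedSolution

theorem mainTheorem9 (M a s m ω lam : ℝ) (hM : 0 < M) (ha : |a| = M)
    (hs : ∃ k : ℤ, s = k / 2) (hm : KerrTeukolsky.Admissible s m) (hm0 : m ≠ 0)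
    (hω : ω = m * KerrTeukolsky.omegaPlus M a)
    (h : ℝ → ℝ) (hh : KerrTeukolsky.IsHyperboloidal M a h)
    (R : ℝ → ℂ) (hR : KerrTeukolsky.IsRadialSolution M a s ω m lam R)
    (hE : KerrTeukolsky.hyperboloidalEnergy M a s ω m h R < ⊤) :
    ∀ r, KerrTeukolsky.rPlus M a < r → R r = 0 := by
  have ha2 : a ^ 2 = M ^ 2 := by rw [← ha, sq_abs]
  have ha0 : a ≠ 0 := fun h0 => by rw [h0] at ha; simp at ha; linarith
  have ham : a * m = 2 * M ^ 2 * ω := by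
    rw [hω, omegaPlus, rPlus_eq ha2]
    field_simp
  have hω0 : ω ≠ 0 := fun h0 => by
    rw [h0, mul_zero] at ham
    exact (mul_ne_zero ha0 hm0) ham
  rw [rPlus_eq ha2]
  have hv := isReducedSolution_reducedPair ha2 ham hR
  set q := 7 * M ^ 2 * ω ^ 2 - lam - s * (s + 1) with hq
  set v := reducedPair M s R with hvdef
  suffices ∀ r, M < r → v.1 r = 0 by
    intro r hr
    have h1 := this r hr
    simpa [hvdef, reducedPair, shiftPow_ne_zero (s + 1) hr] using h1
  obtain ⟨δ, hδ, hδ1, hP⟩ := exists_squareIntegrableUpTo_horizon hM ha2 ham hh hR hE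
  obtain ⟨r₀, hr₀, hQ⟩ := exists_squareIntegrableUpTo_infinity hM ha2 ham hh hR hE
  have hr₀M : M < r₀ := by linarith
  obtain ⟨hPn, hP0⟩ := squareIntegrableUpTo_horizon_reduced ha0 ha2 ham hδ1 hR hP
  -- 𝒟⁺ is the outgoing operator with -ω for ω, hence the use of `hv.neg`: at the horizon the
  -- derivatives lower the spin.
  have hψ : ∀ r, M < r → Complex.I * ((K a ω m r / Delta M a r : ℝ) : ℂ) =
      -(Complex.I * ((-ω : ℝ) : ℂ) * (r + M) / (r - M)) := fun r hr => by
    rw [K_div_Delta ha2 ham hr]; push_cast; ring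
  have hor := memLp_of_squareIntegrableUpTo_zero hψ hv.neg hP0
  rw [sub_add_cancel] at hor
  obtain ⟨k, hk⟩ := hs
  rcases le_or_gt 0 s with hs0 | hs0
  · obtain ⟨n, rfl⟩ : ∃ n : ℕ, k = n := by
      have : (0 : ℝ) ≤ k := by linarith
      exact ⟨k.toNat, (Int.toNat_of_nonneg (by exact_mod_cast this)).symm⟩
    have hn : (n : ℝ) = 2 * s := by rw [hk]; push_cast; ring
    rw [abs_of_nonneg hs0, ← two_mul, ← hn, Nat.floor_natCast] at hPn
    rw [abs_of_nonneg hs0, sub_self, Nat.floor_zero] at hQ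
    obtain ⟨hI₁, hI₂⟩ := memLp_infinity (n := 0) (t := s) hM ha2 ham hr₀ hR (by simp) hv hQ
    have hψc : ContDiffOn ℝ (⊤ : ℕ∞)
        (fun r => Complex.I * ((K a ω m r / Delta M a r : ℝ) : ℂ)) (Ioi M) :=
      contDiffOn_const.mul (contDiffOn_K_div_Delta ha2 ham)
    -- Since n = 2s, x^(s-1) = x^(n-1) x^(-s), the form required by the Bol-type identity.
    have e1 : EqOn (fun r => shiftPow M (s - 1) r * v.1 r)
        (fun r => shiftPow M (n - 1) r * (shiftPow M (-s) r * v.1 r)) (Ioi M) :=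
      fun r hr => by
        beta_reduce
        rw [← mul_assoc, ← shiftPow_add _ _ hr, hn]
        ring_nf
    have e2 : EqOn (fun r => shiftPow M (-s - 1) r * (ladder M (-ω) q (-s) v n).1 r)
        ((twistedDeriv 1 (fun r => Complex.I * ((K a ω m r / Delta M a r : ℝ) : ℂ)))^[n]
          (fun r => shiftPow M (s - 1) r * v.1 r)) (Ioi M) := fun r hr => by
      rw [iterate_twistedDeriv_eqOn e1 n hr, iterate_twistedDeriv_bol hψc
        ((contDiffOn_shiftPow M (-s)).mul hv.contDiffOn.1) n hr]
      beta_reduce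
      rw [hv.neg.iterate_twistedDeriv_shiftPow hψ n hr]
      beta_reduce
      rw [← mul_assoc, ← shiftPow_add _ _ hr]
      ring_nf
    have horW := memLp_of_squareIntegrableUpTo_zero hψ (hv.neg.ladder n)
      (SquareIntegrableUpTo.congr measurableSet_Ioc (fun r hr => hr.1) e2 hPn.iterate)
    rw [sub_add_cancel] at horW
    exact eq_zero_of_regular hM.le hω0 hn hv hδ hr₀M hor.1 hor.2 horW.1 horW.2 hI₁ hI₂
  · obtain ⟨n, rfl⟩ : ∃ n : ℕ, k = -n := by
      have : (k : ℝ) ≤ 0 := by linarith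
      have : k ≤ 0 := by exact_mod_cast this
      exact ⟨(-k).toNat, by rw [Int.toNat_of_nonneg (by omega), neg_neg]⟩
    have hn : (n : ℝ) = 2 * -s := by rw [hk]; push_cast; ring
    rw [abs_of_neg hs0, show -s - s = n by linarith, Nat.floor_natCast] at hQ
    obtain ⟨hI₁, hI₂⟩ := memLp_infinity (t := -s) hM ha2 ham hr₀ hR (by linarith) hv hQ
    have hv₁ : MemLp (fun r => shiftPow M (- -s - 1) r * v.1 r) 2
        (volume.restrict (Ioc M (M + δ))) := by simpa using hor.1
    have hv₂ : MemLp (fun r => shiftPow M (- -s) r * v.2 r) 2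
        (volume.restrict (Ioc M (M + δ))) := by simpa using hor.2
    -- Only j = 0 is available at the horizon; as raising and lowering both preserve the weights
    -- x^(-t-1), x^(-t) with t = -s, U and W inherit them from u.
    obtain ⟨hU₁, hU₂⟩ := memLp_ladder (ω := ω) (q := q) (σ := s) hv₁ hv₂ n
    obtain ⟨hW₁, hW₂⟩ := memLp_ladder (ω := -ω) (q := q) (σ := - -s) hU₁ hU₂ n
    have hU := hv.ladder n
    rw [show s + (n : ℝ) = -s by linarith] at hU
    -- U is needed only with the weights x^(t-1), x^t, which are smaller by the factor x^(2t) ≤ 1.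
    have hraise : ∀ {c : ℝ} {f : ℝ → ℂ},
        MemLp (fun r => shiftPow M c r * f r) 2
          (volume.restrict (Ioc M (M + δ))) →
        MemLp (fun r => shiftPow M (c + 2 * -s) r * f r) 2
          (volume.restrict (Ioc M (M + δ))) := fun {c f} hf => by
      refine memLp_two_congr measurableSet_Ioc (fun r hr => ?_)
        (memLp_two_mul_of_bdd measurableSet_Ioc
          ((contDiffOn_shiftPow M (2 * -s)).continuousOn.mono fun r hr => hr.1) 1
          (fun r hr => ?_) hf)
      · rw [shiftPow_add _ _ hr.1]
        ring
      · rw [norm_shiftPow _ hr.1]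
        exact Real.rpow_le_one (sub_pos.2 hr.1).le (by linarith [hr.2]) (by linarith)
    have hU₁' := hraise hU₁
    have hU₂' := hraise hU₂
    rw [show - -s - 1 + 2 * -s = -s - 1 by ring] at hU₁'
    rw [show - -s + 2 * -s = -s by ring] at hU₂'
    exact eq_zero_of_ladder_eq_zero hv hδ hδ1 (by linarith) hv₁ hv₂
      (eq_zero_of_regular hM.le hω0 hn hU hδ hr₀M hU₁' hU₂' hW₁ hW₂ hI₁ hI₂)
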